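/- **Setting.** Let $\Delta^m,\Delta^n$ be probability simplices, $\mu_{\rm ref}\in\Delta^m$, $\nu_{\rm ref}\in\Delta^n$, $\beta\ge 0$. For $A\in\mathbb R^{m\times n}$ put $$f^{\mu,\nu}(A)=\mu^\top A\nu-\beta\,\mathrm{KL}(\mu\|\mu_{\rm ref})+\beta\,\mathrm{KL}(\nu\|\nu_{\rm ref}),\quad f^{\star,\nu}(A)=\max_{\mu}f^{\mu,\nu}(A),\quad f^{\mu,\star}(A)=\min_{\nu}f^{\mu,\nu}(A),$$ where, if $\beta>0$, only policies of finite KL divergence to the reference are considered (all of the simplex if the reference has full support). Let $\mathrm{Gap}(\mu,\nu)=f^{\star,\nu}(A)-f^{\mu,\star}(A)$ be the duality gap; $(\mu,\nu)$ is an $\varepsilon$-Nash equilibrium if $\mathrm{Gap}(\mu,\nu)\le\varepsilon$. Let $d,T\ge 1$, $\delta\in(0,1)$, $B,\sigma\ge 0$, let $\phi(i,j)\in\mathbb R^d$ be features with $\|\phi(i,j)\|_2\le 1$, let $A_\omega(i,j)=\langle\phi(i,j),\omega\rangle$, and let $\Omega\subseteq\{\omega\in\mathbb R^d:\|\omega\|_2\le\sqrt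 d\}$ be a set with $|A_\omega(i,j)|\le B$ for all $\omega\in\Omega$ and all $i,j$. The unknown payoff matrix $A$ is realizable: $A=A_{\omega^\star}$ for some $\omega^\star\in\Omega$. **Algorithm VMG** (input $\omega_0\in\Omega$, $\alpha$, $T$). In round $t=1,\dots,T$: 1. $(\mu_t,\nu_t)$ is a Nash equilibrium of the (regularised) game with payoff matrix $A_{\omega_{t-1}}$; 2. $\omega_t\in\arg\min_{\omega\in\Omega}\ \sum_{s<t}\big[(A_\omega(i_s,j_s)-y_s)^2+(A_\omega(i'_s,j'_s)-y'_s)^2\big]-\alpha f^{\star,\nu_t}(A_\omega)+\alpha f^{\mu_t,\star}(A_\omega)$; 3. $\widetilde\mu_t\in\arg\max_\mu f^{\mu,\nu_t}(A_{\omega_t})$ and $\widetilde\nu_t\in\arg\min_\nu f^{\mu_t,\nu}(A_{\omega_t})$; 4. given the past, sample $(i_t,j_t)\sim\widetilde\mu_t\otimes\nu_t$ and $(i'_t,j'_t)\sim\mu_t\otimes\widetilde\nu_t$, and observe $y_t,y'_t$, noisy values of $A(i_t,j_t),A(i'_t,j'_t)$ whose noise is $\sigma$-sub-Gaussian given the past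 and the respective entry: $\mathbb E[e^{l\xi}\mid\cdot]\le e^{l^2\sigma^2/2}$ for all $l\in\mathbb R$. Ties are broken by any measurable, possibly randomised, rule depending on the past. Thus $2T$ payoff samples are used in total. Let $\mathrm{Regret}(T)=\sum_{t=1}^T\mathrm{Gap}(\mu_t,\nu_t)$. **Theorem.** There is an absolute constant $C>0$ such that, in every such setting, VMG run with $$\alpha=\sqrt{\frac{T\left(\log(4T/\delta)+d\log(1+2\sqrt d\,T)\right)}{d\log\left(1+(T/d)^{3/2}\right)}}$$ satisfies: (a) with probability at least $1-\delta$, $$\mathrm{Regret}(T)\le C(1+B+\sigma)^2\,d\sqrt T\left(1+\sqrt{\left(\tfrac1d\log\tfrac{4T}\delta+\log(1+2\sqrt d\,T)\right)\log\left(1+(T/d)^{3/2}\right)}\right),$$ that is, $\mathrm{Regret}(T)\le\widetilde O(d\sqrt T)$; (b) for every $\varepsilon>0$, if the number of samples satisfies $$2T\ \ge\ C(1+B+\sigma)^4\,\frac{d^2}{\varepsilon^2}\,\log^2\!\left(2+\frac{(1+B+\sigma)d}{\varepsilon\delta}\right),$$ then with probability at least $1-\delta$ some iterate $(\mu_t,\nu_t)$,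 $t\le T$, is an $\varepsilon$-Nash equilibrium; that is, the sample complexity is $\widetilde O(d^2/\varepsilon^2)$. -/

import Mathlib

open MeasureTheory

namespace VMG

noncomputable section

/-- Kullback-Leibler divergence of two vectors in a finite simplex (used only when `p` vanishes
wherever `q` does, so that it is finite). -/
def kl {m : ℕ} (p q : Fin m → ℝ) : ℝ :=
  ∑ i, p i * Real.log (p i / q i)

/-- The policies a player may use: the points `p` of the simplex for which `β * KL(p ‖ ref)` is
finite. This is the whole simplex if `β = 0` or if `ref` has full support; otherwise the excluded
policies are those with `KL(p ‖ ref) = +∞`, which are never optimal. -/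
def policies {m : ℕ} (β : ℝ) (ref : Fin m → ℝ) : Set (Fin m → ℝ) :=
  {p | p ∈ stdSimplex ℝ (Fin m) ∧ (β ≠ 0 → ∀ i, ref i = 0 → p i = 0)}

/-- The data that fix the KL-regularised two-player zero-sum matrix game up to its payoff matrix:
the regularisation parameter and the two reference policies. -/
structure Reg (m n : ℕ) where
  β : ℝ
  β_nonneg : 0 ≤ β
  μref : Fin m → ℝ
  μref_mem : μref ∈ stdSimplex ℝ (Fin m)
  νref : Fin n → ℝ
  νref_mem : νref ∈ stdSimplex ℝ (Fin n)

variable {m n d : ℕ}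

/-- `f^{μ,ν}(A) = μᵀ A ν - β KL(μ ‖ μref) + β KL(ν ‖ νref)`. -/
def value (R : Reg m n) (A : Matrix (Fin m) (Fin n) ℝ) (μ : Fin m → ℝ) (ν : Fin n → ℝ) : ℝ :=
  (∑ i, ∑ j, μ i * A i j * ν j) - R.β * kl μ R.μref + R.β * kl ν R.νref

/-- Policies of the max player. -/
def maxPolicies (R : Reg m n) : Set (Fin m → ℝ) := policies R.β R.μref

/-- Policies of the min player. -/
def minPolicies (R : Reg m n) : Set (Fin n → ℝ) := policies R.β R.νref

/-- `f^{⋆,ν}(A) = max_μ f^{μ,ν}(A)`. -/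
def bestMax (R : Reg m n) (A : Matrix (Fin m) (Fin n) ℝ) (ν : Fin n → ℝ) : ℝ :=
  sSup ((fun μ => value R A μ ν) '' maxPolicies R)

/-- `f^{μ,⋆}(A) = min_ν f^{μ,ν}(A)`. -/
def bestMin (R : Reg m n) (A : Matrix (Fin m) (Fin n) ℝ) (μ : Fin m → ℝ) : ℝ :=
  sInf ((fun ν => value R A μ ν) '' minPolicies R)

/-- `(μ, ν)` is a Nash equilibrium (saddle point) of the regularised game with payoff `A`. -/
def IsNash (R : Reg m n) (A : Matrix (Fin m) (Fin n) ℝ) (μ : Fin m → ℝ) (ν : Fin n → ℝ) : Prop :=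
  μ ∈ maxPolicies R ∧ ν ∈ minPolicies R ∧
    IsMaxOn (fun μ' => value R A μ' ν) (maxPolicies R) μ ∧
    IsMinOn (fun ν' => value R A μ ν') (minPolicies R) ν

/-- The duality gap `f^{⋆,ν}(A) - f^{μ,⋆}(A)`. -/
def dualGap (R : Reg m n) (A : Matrix (Fin m) (Fin n) ℝ) (μ : Fin m → ℝ) (ν : Fin n → ℝ) : ℝ :=
  bestMax R A ν - bestMin R A μ

/-- `(μ, ν)` is an `ε`-Nash equilibrium, measured by the duality gap. -/
def IsApproxNash (R : Reg m n) (A : Matrix (Fin m) (Fin n) ℝ) (ε : ℝ)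
    (μ : Fin m → ℝ) (ν : Fin n → ℝ) : Prop :=
  μ ∈ maxPolicies R ∧ ν ∈ minPolicies R ∧ dualGap R A μ ν ≤ ε

/-- The linear payoff model `A_ω(i,j) = ⟨φ(i,j), ω⟩`. -/
def payoff (φ : Fin m → Fin n → EuclideanSpace ℝ (Fin d)) (ω : EuclideanSpace ℝ (Fin d)) :
    Matrix (Fin m) (Fin n) ℝ :=
  Matrix.of fun i j => inner ℝ (φ i j) ω

/-- The objective minimised over `ω` in the model update, for the data
`(i s, j s, y s)`, `(i' s, j' s, y' s)`, `s < k`, collected in the first `k` rounds. -/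
def objective (R : Reg m n) (φ : Fin m → Fin n → EuclideanSpace ℝ (Fin d)) (α : ℝ) (k : ℕ)
    (i : ℕ → Fin m) (j : ℕ → Fin n) (y : ℕ → ℝ) (i' : ℕ → Fin m) (j' : ℕ → Fin n) (y' : ℕ → ℝ)
    (μ : Fin m → ℝ) (ν : Fin n → ℝ) (ω : EuclideanSpace ℝ (Fin d)) : ℝ :=
  (∑ s ∈ Finset.range k,
      ((payoff φ ω (i s) (j s) - y s) ^ 2 + (payoff φ ω (i' s) (j' s) - y' s) ^ 2))
    - α * bestMax R (payoff φ ω) ν + α * bestMin R (payoff φ ω) μ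

/-- The noise `y - A(i,j)` of an observation `y` of the payoff at the random entry `(i,j)` is
conditionally `σ`-sub-Gaussian given the past `𝓕` and the queried entry. -/
def SubGaussianFeedback {S : Type*} [mS : MeasurableSpace S] (P : Measure S)
    (A : Matrix (Fin m) (Fin n) ℝ) (σ : ℝ) (𝓕 : MeasurableSpace S)
    (i : S → Fin m) (j : S → Fin n) (y : S → ℝ) : Prop :=
  ∀ l : ℝ, Integrable (fun x => Real.exp (l * (y x - A (i x) (j x)))) P ∧
    P[fun x => Real.exp (l * (y x - A (i x) (j x))) |
        𝓕 ⊔ MeasurableSpace.comap (fun x => (i x, j x)) ⊤]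
      ≤ᵐ[P] fun _ => Real.exp (l ^ 2 * σ ^ 2 / 2)

/-- Given the past `𝓕`, the random entry `(i,j)` is drawn from the product distribution `p ⊗ q`. -/
def DrawnFrom {S : Type*} [mS : MeasurableSpace S] (P : Measure S) (𝓕 : MeasurableSpace S)
    (i : S → Fin m) (j : S → Fin n) (p : S → Fin m → ℝ) (q : S → Fin n → ℝ) : Prop :=
  ∀ a b, P[Set.indicator {x | i x = a ∧ j x = b} (fun _ => (1 : ℝ)) | 𝓕]
    =ᵐ[P] fun x => p x a * q x b

/-- A run of `T` rounds of the algorithm on a probability space `(S, P)`, against the unknown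
payoff matrix `A`, with parameter set `Θ`, initial parameter `ω₀`, coefficient `α` and noise level
`σ`. Rounds are numbered `k = 0, …, T - 1`: round `k` here is round `t = k + 1` in one-based
numbering, so `ω k` is the parameter on entering that round and `ω (k + 1)` the one it computes.
`ℱ k` is the information available before sampling in round `k`; it may contain randomness beyond
the data, so every (possibly randomised) rule for breaking ties in the optimisations is allowed. -/
structure Run {S : Type*} [mS : MeasurableSpace S] (P : Measure S) (R : Reg m n)
    (A : Matrix (Fin m) (Fin n) ℝ) (φ : Fin m → Fin n → EuclideanSpace ℝ (Fin d))
    (Θ : Set (EuclideanSpace ℝ (Fin d))) (ω₀ : EuclideanSpace ℝ (Fin d)) (α σ : ℝ) (T : ℕ) where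
  ℱ : Filtration ℕ mS
  /-- model parameters -/
  ω : ℕ → S → EuclideanSpace ℝ (Fin d)
  /-- equilibrium policies of the current model -/
  μ : ℕ → S → Fin m → ℝ
  ν : ℕ → S → Fin n → ℝ
  /-- best responses in the updated model -/
  μt : ℕ → S → Fin m → ℝ
  νt : ℕ → S → Fin n → ℝ
  /-- the two queried entries and the noisy payoffs observed there -/
  i : ℕ → S → Fin m
  j : ℕ → S → Fin n
  y : ℕ → S → ℝ
  i' : ℕ → S → Fin m
  j' : ℕ → S → Fin n
  y' : ℕ → S → ℝ
  measurable_ω : ∀ k < T, Measurable[ℱ k] (ω (k + 1))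
  measurable_μ : ∀ k < T, Measurable[ℱ k] (μ k)
  measurable_ν : ∀ k < T, Measurable[ℱ k] (ν k)
  measurable_μt : ∀ k < T, Measurable[ℱ k] (μt k)
  measurable_νt : ∀ k < T, Measurable[ℱ k] (νt k)
  measurable_i : ∀ k < T, Measurable[ℱ (k + 1)] (i k)
  measurable_j : ∀ k < T, Measurable[ℱ (k + 1)] (j k)
  measurable_y : ∀ k < T, Measurable[ℱ (k + 1)] (y k)
  measurable_i' : ∀ k < T, Measurable[ℱ (k + 1)] (i' k)
  measurable_j' : ∀ k < T, Measurable[ℱ (k + 1)] (j' k)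
  measurable_y' : ∀ k < T, Measurable[ℱ (k + 1)] (y' k)
  /-- initialisation -/
  init : ∀ x, ω 0 x = ω₀
  /-- policy update: solve the game of the current model -/
  nash : ∀ k < T, ∀ x, IsNash R (payoff φ (ω k x)) (μ k x) (ν k x)
  /-- value-incentivised model update on the data of the previous rounds -/
  model_mem : ∀ k < T, ∀ x, ω (k + 1) x ∈ Θ
  model_min : ∀ k < T, ∀ x,
    IsMinOn (objective R φ α k (fun s => i s x) (fun s => j s x) (fun s => y s x)
      (fun s => i' s x) (fun s => j' s x) (fun s => y' s x) (μ k x) (ν k x)) Θ (ω (k + 1) x)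
  /-- best responses in the updated model -/
  μt_mem : ∀ k < T, ∀ x, μt k x ∈ maxPolicies R
  μt_max : ∀ k < T, ∀ x,
    IsMaxOn (fun p => value R (payoff φ (ω (k + 1) x)) p (ν k x)) (maxPolicies R) (μt k x)
  νt_mem : ∀ k < T, ∀ x, νt k x ∈ minPolicies R
  νt_min : ∀ k < T, ∀ x,
    IsMinOn (fun q => value R (payoff φ (ω (k + 1) x)) (μ k x) q) (minPolicies R) (νt k x)
  /-- data collection -/
  draw : ∀ k < T, DrawnFrom P (ℱ k) (i k) (j k) (μt k) (ν k)
  draw' : ∀ k < T, DrawnFrom P (ℱ k) (i' k) (j' k) (μ k) (νt k)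
  noise : ∀ k < T, SubGaussianFeedback P A σ (ℱ k) (i k) (j k) (y k)
  noise' : ∀ k < T, SubGaussianFeedback P A σ (ℱ k) (i' k) (j' k) (y' k)

/-- The cumulative duality gap of the equilibrium policies played in the `T` rounds. -/
def Run.regret {S : Type*} [MeasurableSpace S] {P : Measure S} {R : Reg m n}
    {A : Matrix (Fin m) (Fin n) ℝ} {φ : Fin m → Fin n → EuclideanSpace ℝ (Fin d)}
    {Θ : Set (EuclideanSpace ℝ (Fin d))} {ω₀ : EuclideanSpace ℝ (Fin d)} {α σ : ℝ} {T : ℕ}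
    (r : Run P R A φ Θ ω₀ α σ T) (x : S) : ℝ :=
  ∑ k ∈ Finset.range T, dualGap R A (r.μ k x) (r.ν k x)

/-- The choice of the regularisation coefficient `α`. -/
def alpha (d T : ℕ) (δ : ℝ) : ℝ :=
  √(T * (Real.log (4 * T / δ) + d * Real.log (1 + 2 * √d * T)) /
    (d * Real.log (1 + ((T : ℝ) / d) ^ (3 / 2 : ℝ))))

end

end VMG

namespace VMG

/-! Optimism comes from the model update itself. Compared with the true parameter `ω₁` (so `A =
payoff φ ω₁`), minimality of `ω (k+1)` bounds the true duality gap in round `k` by the gap in the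
model `ω (k+1)` plus `1/α` times the difference of squared losses (`Run.dualGap_le`). Since `(μ k, ν
k)` is an equilibrium of the model `ω k`, its gap in the model `ω (k+1)` is at most the change of
model seen by the two best responses (`dualGap_payoff_le`). The KL terms cancel, so this change is
linear: mean features paired with `ω (k+1) - ω k`, which is split around `ω₁` into two prediction
errors.

The elliptical potential lemma bounds the summed errors by `K d log (1+T)` plus `1/K` times squared
errors on past queries, for any `K > 0` (`sum_abs_dotProduct_add_le`). Those squared errors are paid
for by the losses: an exponential supermartingale and a `1/T`-net show that, uniformly over `Θ`, the
loss of `ω₁` exceeds that of `ω` by at most `O(complexity)` minus a quarter of the expected squared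
deviation (`Feedback.exists_event`). With `K = 4α` the squared errors cancel exactly, leaving `α d
log (1+T) + T * complexity / α` up to constants (`Run.regret_le`), which `alpha` balances. When `T ≤
d²` the regret bound is trivial, because gaps are bounded.

For part (b), some gap is at most the average regret, so it suffices to invert the rate
(`rate_le_of_le`). -/

open Matrix in
/-- The regularised Gram matrix `1 + ∑_{s<t} x_s x_sᵀ`. -/
def gram {d : ℕ} (x : ℕ → Fin d → ℝ) (t : ℕ) : Matrix (Fin d) (Fin d) ℝ :=
  1 + ∑ s ∈ Finset.range t, vecMulVec (x s) (x s)

/-! ### Gram matrices and the elliptical potential. -/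

section EllipticalPotential

open Matrix

variable {d : ℕ} (x : ℕ → Fin d → ℝ)

lemma gram_succ (t : ℕ) : gram x (t + 1) = gram x t + vecMulVec (x t) (x t) := by
  simp [gram, Finset.sum_range_succ, add_assoc]

lemma dotProduct_gram_mulVec (t : ℕ) (u v : Fin d → ℝ) :
    u ⬝ᵥ (gram x t *ᵥ v) = u ⬝ᵥ v + ∑ s ∈ Finset.range t, (x s ⬝ᵥ u) * (x s ⬝ᵥ v) := by
  induction t with
  | zero => simp [gram]
  | succ t ih =>
    rw [gram_succ, add_mulVec, dotProduct_add, ih, Finset.sum_range_succ, vecMulVec_mulVec,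
      op_smul_eq_smul, dotProduct_smul, dotProduct_comm u (x t), smul_eq_mul]
    ring

lemma gram_posDef (t : ℕ) : (gram x t).PosDef := by
  refine PosDef.one.add_posSemidef ?_
  refine posSemidef_sum _ fun s _ => ?_
  simpa using posSemidef_vecMulVec_self_star (x s)

lemma gram_mulVec_inv (t : ℕ) (u : Fin d → ℝ) : gram x t *ᵥ ((gram x t)⁻¹ *ᵥ u) = u := by
  rw [mulVec_mulVec, mul_nonsing_inv _ (gram_posDef x t).det_pos.ne'.isUnit, one_mulVec]

/-- The matrix determinant lemma for a rank-one update; it makes `log det` telescope in the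
potential argument. -/
lemma det_gram_succ (t : ℕ) :
    (gram x (t + 1)).det = (gram x t).det * (1 + x t ⬝ᵥ ((gram x t)⁻¹ *ᵥ x t)) := by
  have h := det_add_replicateCol_mul_replicateRow (ι := Unit)
    (gram_posDef x t).det_pos.ne'.isUnit (x t) (x t)
  rw [gram_succ, vecMulVec_eq Unit, h]
  congr 1
  rw [det_unique, Matrix.add_apply, one_apply_eq, Matrix.mul_assoc]
  congr 1
variable {x}

/-- Each eigenvalue is the Rayleigh quotient `1 + ∑ (x s ⬝ᵥ v)²` of a unit eigenvector, hence at
most `1 + t`. -/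
lemma det_gram_le {t : ℕ} (hx : ∀ s < t, x s ⬝ᵥ x s ≤ 1) : (gram x t).det ≤ (1 + t : ℝ) ^ d := by
  have hpd := gram_posDef x t
  rw [hpd.isHermitian.det_eq_prod_eigenvalues]
  calc _ ≤ ∏ _i : Fin d, (1 + t : ℝ) := by
        refine Finset.prod_le_prod (fun i _ => (hpd.eigenvalues_pos i).le) fun i _ => ?_
        set v := (hpd.isHermitian.eigenvectorBasis i).ofLp with hv
        have hvv : v ⬝ᵥ v = 1 := by
          have := hpd.isHermitian.eigenvectorBasis.orthonormal.1 i
          have h2 : inner ℝ (hpd.isHermitian.eigenvectorBasis i)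
              (hpd.isHermitian.eigenvectorBasis i) = (1 : ℝ) := by
            rw [real_inner_self_eq_norm_sq, this]; norm_num
          rw [EuclideanSpace.inner_eq_star_dotProduct] at h2
          simpa using h2
        have he := hpd.isHermitian.eigenvalues_eq i
        rw [← hv, star_trivial, dotProduct_gram_mulVec, hvv] at he
        simp only [RCLike.ofReal_real_eq_id, id, he, RCLike.re_to_real]
        gcongr
        calc _ ≤ ∑ s ∈ Finset.range t, (1 : ℝ) := by
              refine Finset.sum_le_sum fun s hs => ?_
              have hcs : (x s ⬝ᵥ v) ^ 2 ≤ (x s ⬝ᵥ x s) * (v ⬝ᵥ v) := by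
                simpa [dotProduct, sq] using
                  Finset.sum_mul_sq_le_sq_mul_sq Finset.univ (x s) v
              rw [hvv, mul_one] at hcs
              rw [← sq]
              exact hcs.trans (hx s (Finset.mem_range.1 hs))
          _ = t := by simp
    _ = _ := by simp

lemma dotProduct_gram_inv_nonneg (t : ℕ) (u : Fin d → ℝ) :
    0 ≤ u ⬝ᵥ ((gram x t)⁻¹ *ᵥ u) := by
  simpa using (gram_posDef x t).inv.posSemidef.dotProduct_mulVec_nonneg u

lemma dotProduct_gram_inv_le_one {t : ℕ} {u : Fin d → ℝ} (hu : u ⬝ᵥ u ≤ 1) :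
    u ⬝ᵥ ((gram x t)⁻¹ *ᵥ u) ≤ 1 := by
  set z := (gram x t)⁻¹ *ᵥ u with hz
  have h1 : z ⬝ᵥ (gram x t *ᵥ z) = u ⬝ᵥ z := by
    rw [hz, gram_mulVec_inv, dotProduct_comm]
  have h2 : z ⬝ᵥ z ≤ u ⬝ᵥ z := by
    rw [← h1, dotProduct_gram_mulVec]
    have : 0 ≤ ∑ s ∈ Finset.range t, (x s ⬝ᵥ z) * (x s ⬝ᵥ z) :=
      Finset.sum_nonneg fun s _ => mul_self_nonneg _
    linarith
  have h3 : (u ⬝ᵥ z) ^ 2 ≤ (u ⬝ᵥ u) * (z ⬝ᵥ z) := by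
    simpa [dotProduct, sq] using Finset.sum_mul_sq_le_sq_mul_sq Finset.univ u z
  have h4 : 0 ≤ z ⬝ᵥ z := by simpa using dotProduct_star_self_nonneg z
  nlinarith

/-- The elliptical potential lemma. -/
lemma sum_dotProduct_gram_inv_le {T : ℕ} (hx : ∀ s < T, x s ⬝ᵥ x s ≤ 1) :
    ∑ t ∈ Finset.range T, x t ⬝ᵥ ((gram x t)⁻¹ *ᵥ x t) ≤ 2 * (d * Real.log (1 + T)) := by
  have key : ∀ k ≤ T, ∑ t ∈ Finset.range k, x t ⬝ᵥ ((gram x t)⁻¹ *ᵥ x t)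
      ≤ 2 * Real.log (gram x k).det := by
    intro k hk
    induction k with
    | zero => simp [gram]
    | succ k ih =>
      have h0 := dotProduct_gram_inv_nonneg (x := x) k (x k)
      have h1 := dotProduct_gram_inv_le_one (x := x) (t := k) (hx k hk)
      have ih := ih (Nat.le_of_succ_le hk)
      rw [Finset.sum_range_succ, det_gram_succ,
        Real.log_mul (gram_posDef x k).det_pos.ne' (by positivity)]
      set a := x k ⬝ᵥ ((gram x k)⁻¹ *ᵥ x k)
      -- Valid because `0 ≤ a ≤ 1`; it compares the summand with the increment of `log det`.
      have h2 : a / 2 ≤ Real.log (1 + a) := by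
        have := Real.one_sub_inv_le_log_of_pos (x := 1 + a) (by positivity)
        refine le_trans ?_ this
        rw [← sub_nonneg]
        have : 1 - (1 + a)⁻¹ - a / 2 = a * (1 - a) / (2 * (1 + a)) := by
          field_simp
          ring
        rw [this]
        have : 0 ≤ 1 - a := by linarith
        positivity
      linarith
  refine (key T le_rfl).trans ?_
  have := Real.log_le_log (gram_posDef x T).det_pos (det_gram_le hx)
  rw [Real.log_pow] at this
  linarith

/-- Cauchy–Schwarz for the dual norms of `V = gram x t`, in additive form: the quadratic form of `V`
is nonnegative at `c V⁻¹v + u`, and `c = ±K` gives both signs. The weight `K` stays free, to be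
matched with `α` later. -/
lemma abs_dotProduct_le_gram (t : ℕ) (v u : Fin d → ℝ) {K : ℝ} (hK : 0 < K) :
    |v ⬝ᵥ u| ≤ K / 2 * (v ⬝ᵥ ((gram x t)⁻¹ *ᵥ v)) + (u ⬝ᵥ (gram x t *ᵥ u)) / (2 * K) := by
  have key : ∀ c : ℝ, 0 ≤ c ^ 2 * (v ⬝ᵥ ((gram x t)⁻¹ *ᵥ v)) + 2 * c * (v ⬝ᵥ u)
      + u ⬝ᵥ (gram x t *ᵥ u) := by
    intro c
    set z := (gram x t)⁻¹ *ᵥ v with hz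
    have hV : gram x t *ᵥ z = v := gram_mulVec_inv x t v
    have h := (gram_posDef x t).posSemidef.dotProduct_mulVec_nonneg (c • z + u)
    rw [star_trivial, mulVec_add, mulVec_smul, hV] at h
    have hs : z ⬝ᵥ (gram x t *ᵥ u) = v ⬝ᵥ u := by
      rw [← hV, dotProduct_gram_mulVec, dotProduct_comm (gram x t *ᵥ z),
        dotProduct_gram_mulVec, dotProduct_comm u z]
      congr 1
      exact Finset.sum_congr rfl fun _ _ => mul_comm _ _
    simp only [add_dotProduct, dotProduct_add, smul_dotProduct, dotProduct_smul, smul_eq_mul,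
      hs] at h
    rw [dotProduct_comm z v, dotProduct_comm u v] at h
    nlinarith
  have h1 := key K
  have h2 := key (-K)
  have e : K / 2 * (v ⬝ᵥ ((gram x t)⁻¹ *ᵥ v)) + (u ⬝ᵥ (gram x t *ᵥ u)) / (2 * K)
      = (K ^ 2 * (v ⬝ᵥ ((gram x t)⁻¹ *ᵥ v)) + u ⬝ᵥ (gram x t *ᵥ u)) / (2 * K) := by
    field_simp
  rw [e, le_div_iff₀ (by positivity)]
  rcases abs_cases (v ⬝ᵥ u) with ⟨h, _⟩ | ⟨h, _⟩ <;> rw [h] <;> nlinarith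

/-- Prediction errors in the directions `x_t` are controlled by the in-sample errors. -/
lemma sum_abs_dotProduct_le {T : ℕ} (hx : ∀ s < T, x s ⬝ᵥ x s ≤ 1) (u : ℕ → Fin d → ℝ) {K : ℝ}
    (hK : 0 < K) :
    ∑ t ∈ Finset.range T, |x t ⬝ᵥ u t| ≤ K * (d * Real.log (1 + T)) +
      (∑ t ∈ Finset.range T, (u t ⬝ᵥ u t + ∑ s ∈ Finset.range t, (x s ⬝ᵥ u t) ^ 2)) / (2 * K) := by
  calc _ ≤ ∑ t ∈ Finset.range T, (K / 2 * (x t ⬝ᵥ ((gram x t)⁻¹ *ᵥ x t))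
          + (u t ⬝ᵥ (gram x t *ᵥ u t)) / (2 * K)) :=
        Finset.sum_le_sum fun t _ => abs_dotProduct_le_gram t _ _ hK
    _ = K / 2 * ∑ t ∈ Finset.range T, x t ⬝ᵥ ((gram x t)⁻¹ *ᵥ x t)
          + (∑ t ∈ Finset.range T, (u t ⬝ᵥ u t + ∑ s ∈ Finset.range t, (x s ⬝ᵥ u t) ^ 2))
            / (2 * K) := by
        simp only [dotProduct_gram_mulVec, ← sq]
        rw [Finset.sum_add_distrib, Finset.mul_sum, Finset.sum_div]
    _ ≤ _ := by
        have := mul_le_mul_of_nonneg_left (sum_dotProduct_gram_inv_le hx) (half_pos hK).le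
        linarith

/-- Both the current and the previous prediction errors in the directions `x_t` are controlled by
the in-sample errors of the current model. -/
lemma sum_abs_dotProduct_add_le {T : ℕ} (hx : ∀ s < T, x s ⬝ᵥ x s ≤ 1) {u : ℕ → Fin d → ℝ}
    {U V K : ℝ} (hu : ∀ k ≤ T, u k ⬝ᵥ u k ≤ U) (hV : 0 ≤ V)
    (hxu : ∀ k < T, (x k ⬝ᵥ u (k + 1)) ^ 2 ≤ V) (hK : 0 < K) :
    ∑ k ∈ Finset.range T, (|x k ⬝ᵥ u (k + 1)| + |x k ⬝ᵥ u k|) ≤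
      2 * K * (d * Real.log (1 + T)) + (T * U + T * V / 2 +
        ∑ k ∈ Finset.range T, ∑ s ∈ Finset.range k, (x s ⬝ᵥ u (k + 1)) ^ 2) / K := by
  have h1 := sum_abs_dotProduct_le hx (fun k => u (k + 1)) hK
  have h2 := sum_abs_dotProduct_le hx u hK
  set Q := ∑ k ∈ Finset.range T, ∑ s ∈ Finset.range k, (x s ⬝ᵥ u (k + 1)) ^ 2 with hQ
  -- Shift of index: `u (k+1)` over `s < k+1` is its in-sample error over `s < k`, counted in `Q`,
  -- plus one fresh square at `s = k`, at most `V`. The term `k = 0` is empty.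
  have h3 : ∑ k ∈ Finset.range T, ∑ s ∈ Finset.range k, (x s ⬝ᵥ u k) ^ 2 ≤ Q + T * V := by
    cases T with
    | zero => simp [hQ]
    | succ N =>
      rw [Finset.sum_range_succ', Finset.range_zero, Finset.sum_empty, add_zero, hQ]
      simp_rw [Finset.sum_range_succ _ (_ : ℕ)]
      rw [Finset.sum_add_distrib]
      have h4 : ∑ k ∈ Finset.range N, (x k ⬝ᵥ u (k + 1)) ^ 2 ≤ N * V := by
        refine (Finset.sum_le_sum fun k hk =>
          hxu k ((Finset.mem_range.1 hk).trans (Nat.lt_succ_self N))).trans ?_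
        simp
      have h5 : 0 ≤ ∑ s ∈ Finset.range N, (x s ⬝ᵥ u (N + 1)) ^ 2 :=
        Finset.sum_nonneg fun _ _ => sq_nonneg _
      push_cast
      linarith
  have h6 : ∀ w : ℕ → Fin d → ℝ, (∀ k < T, w k ⬝ᵥ w k ≤ U) →
      ∑ k ∈ Finset.range T, w k ⬝ᵥ w k ≤ T * U := by
    intro w hw
    refine (Finset.sum_le_sum fun k hk => hw k (Finset.mem_range.1 hk)).trans ?_
    simp
  have h7 := h6 u fun k hk => hu k hk.le
  have h8 := h6 (fun k => u (k + 1)) fun k hk => hu (k + 1) hk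
  rw [Finset.sum_add_distrib] at h1 h2 ⊢
  have h9 : ∀ a b : ℝ, a ≤ T * U → b ≤ Q + T * V → (a + b) / (2 * K)
      ≤ (T * U + (Q + T * V)) / (2 * K) := fun a b ha hb => by gcongr
  have h10 := h9 _ _ h7 h3
  have h11 : (∑ k ∈ Finset.range T, u (k + 1) ⬝ᵥ u (k + 1) + Q) / (2 * K)
      ≤ (T * U + Q) / (2 * K) := by gcongr
  have h12 : (T * U + T * V / 2 + Q) / K
      = (T * U + Q) / (2 * K) + (T * U + (Q + T * V)) / (2 * K) := by
    field_simp
    ring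
  rw [h12]
  linarith

end EllipticalPotential

/-! ### Exponential moments of the loss in one round. -/

section OneRound

variable {S : Type*} {m n : ℕ}

lemma measurable_entry [MeasurableSpace S] {i : S → Fin m} {j : S → Fin n} (hi : Measurable i)
    (hj : Measurable j) (G : Fin m → Fin n → ℝ) : Measurable fun x => G (i x) (j x) :=
  (measurable_of_countable fun ab : Fin m × Fin n => G ab.1 ab.2).comp (hi.prodMk hj)

lemma measurableSet_entry [MeasurableSpace S] {i : S → Fin m} {j : S → Fin n} (hi : Measurable i)
    (hj : Measurable j) (a : Fin m) (b : Fin n) : MeasurableSet {x | i x = a ∧ j x = b} :=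
  (hi (measurableSet_singleton a)).inter (hj (measurableSet_singleton b))

lemma measure_ge_le_exp_neg [MeasurableSpace S] {P : Measure S} {X : S → ℝ} (hX : Measurable X) {c : ℝ}
    (h : ∫⁻ x, ENNReal.ofReal (Real.exp (X x)) ∂P ≤ ENNReal.ofReal (Real.exp c)) (u : ℝ) :
    P {x | u ≤ X x} ≤ ENNReal.ofReal (Real.exp (c - u)) := by
  have h1 := mul_meas_ge_le_lintegral (μ := P) hX.exp.ennreal_ofReal (ENNReal.ofReal (Real.exp u))
  have hset : {x | ENNReal.ofReal (Real.exp u) ≤ ENNReal.ofReal (Real.exp (X x))}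
      = {x | u ≤ X x} := by
    ext x
    simp [ENNReal.ofReal_le_ofReal_iff (Real.exp_pos (X x)).le]
  rw [hset] at h1
  have h2 := mul_le_mul_right (h1.trans h) (ENNReal.ofReal (Real.exp (-u)))
  rw [← mul_assoc, ← ENNReal.ofReal_mul (Real.exp_pos _).le,
    ← ENNReal.ofReal_mul (Real.exp_pos _).le, ← Real.exp_add, ← Real.exp_add] at h2
  simpa [sub_eq_neg_add] using h2

/-- The excess of the squared loss of the true payoff matrix `A` over that of `A + G` on one
observation, plus a quarter of the expected squared deviation. -/
noncomputable def excess (A G : Matrix (Fin m) (Fin n) ℝ) (a : Fin m) (b : Fin n) (y : ℝ)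
    (p : Fin m → ℝ) (q : Fin n → ℝ) : ℝ :=
  2 * G a b * (y - A a b) - G a b ^ 2 + 1 / 4 * ∑ a', ∑ b', p a' * q b' * G a' b' ^ 2

lemma measurable_excess [MeasurableSpace S] {i : S → Fin m} {j : S → Fin n} {y : S → ℝ}
    {p : S → Fin m → ℝ} {q : S → Fin n → ℝ} (hi : Measurable i) (hj : Measurable j) (hy : Measurable y)
    (hp : Measurable p) (hq : Measurable q) (A G : Matrix (Fin m) (Fin n) ℝ) :
    Measurable fun x => excess A G (i x) (j x) (y x) (p x) (q x) := by
  unfold excess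
  have h1 := measurable_entry hi hj G
  have h2 := measurable_entry hi hj A
  have h3 : ∀ a, Measurable fun x => p x a := fun a => (measurable_pi_apply a).comp hp
  have h4 : ∀ b, Measurable fun x => q x b := fun b => (measurable_pi_apply b).comp hq
  refine Measurable.add (((h1.const_mul 2).mul (hy.sub h2)).sub (h1.pow_const 2))
    (Measurable.const_mul ?_ _)
  exact Finset.measurable_sum _ fun a _ => Finset.measurable_sum _ fun b _ =>
    ((h3 a).mul (h4 b)).mul_const _

variable {F : MeasurableSpace S} [mS : MeasurableSpace S] {P : Measure S} [IsProbabilityMeasure P]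
  {A : Matrix (Fin m) (Fin n) ℝ} {σ : ℝ}
  {i : S → Fin m} {j : S → Fin n} {y : S → ℝ} {p : S → Fin m → ℝ} {q : S → Fin n → ℝ}

/-- Restricting to one queried entry turns the random multiplier `G (i x) (j x)` into a constant, so
that the sub-Gaussian hypothesis, which has a deterministic `l`, applies. -/
lemma setLIntegral_exp_noise_le (hF : F ≤ mS) (hi : Measurable i) (hj : Measurable j)
    (hn : SubGaussianFeedback P A σ F i j y) {s : Set S} (hs : MeasurableSet[F] s)
    (a : Fin m) (b : Fin n) (l : ℝ) :
    ∫⁻ x in s ∩ {x | i x = a ∧ j x = b}, ENNReal.ofReal (Real.exp (l * (y x - A a b))) ∂P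
      ≤ ENNReal.ofReal (Real.exp (l ^ 2 * σ ^ 2 / 2)) * P (s ∩ {x | i x = a ∧ j x = b}) := by
  obtain ⟨hint, hle⟩ := hn l
  set t := s ∩ {x | i x = a ∧ j x = b} with ht
  have hG : F ⊔ MeasurableSpace.comap (fun x => (i x, j x)) ⊤ ≤ mS := by
    refine sup_le hF ?_
    have := (hi.prodMk hj).comap_le
    rwa [show (Prod.instMeasurableSpace : MeasurableSpace (Fin m × Fin n)) = ⊤ from
      eq_top_iff.2 fun s _ => s.to_countable.measurableSet] at this
  have htG : MeasurableSet[F ⊔ MeasurableSpace.comap (fun x => (i x, j x)) ⊤] t := by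
    refine MeasurableSet.inter (le_sup_left (α := MeasurableSpace S) _ hs) ?_
    refine le_sup_right (α := MeasurableSpace S) _ ⟨{(a, b)}, trivial, ?_⟩
    ext x
    simp
  have htm : MeasurableSet t := hG _ htG
  have h1 := setIntegral_condExp hG hint htG
  have h2 : ∫ x in t, Real.exp (l * (y x - A (i x) (j x))) ∂P
      ≤ Real.exp (l ^ 2 * σ ^ 2 / 2) * P.real t := by
    rw [← h1]
    refine (setIntegral_mono_ae integrable_condExp.integrableOn
      (integrable_const _).integrableOn hle).trans ?_
    simp [mul_comm]
  calc _ = ∫⁻ x in t, ENNReal.ofReal (Real.exp (l * (y x - A (i x) (j x)))) ∂P := by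
        refine setLIntegral_congr_fun htm fun x hx => ?_
        simp only [hx.2.1, hx.2.2]
    _ = ENNReal.ofReal (∫ x in t, Real.exp (l * (y x - A (i x) (j x))) ∂P) := by
        rw [ofReal_integral_eq_lintegral_ofReal hint.integrableOn]
        exact Filter.Eventually.of_forall fun _ => (Real.exp_pos _).le
    _ ≤ ENNReal.ofReal (Real.exp (l ^ 2 * σ ^ 2 / 2) * P.real t) := ENNReal.ofReal_le_ofReal h2
    _ = _ := by
        rw [ENNReal.ofReal_mul (Real.exp_pos _).le, ofReal_measureReal]

lemma measure_inter_entry_eq (hF : F ≤ mS) (hi : Measurable i) (hj : Measurable j)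
    (hd : DrawnFrom P F i j p q) (hp : ∀ x a, 0 ≤ p x a) (hq : ∀ x b, 0 ≤ q x b)
    {s : Set S} (hs : MeasurableSet[F] s) (a : Fin m) (b : Fin n) :
    P (s ∩ {x | i x = a ∧ j x = b}) = ∫⁻ x in s, ENNReal.ofReal (p x a * q x b) ∂P := by
  have hE := measurableSet_entry hi hj a b
  have hint : Integrable (Set.indicator {x | i x = a ∧ j x = b} fun _ => (1 : ℝ)) P :=
    (integrable_const 1).indicator hE
  have h1 := setIntegral_condExp hF hint hs
  rw [integral_indicator hE, Measure.restrict_restrict hE, setIntegral_const, smul_eq_mul,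
    mul_one] at h1
  have h2 : ∫ x in s, p x a * q x b ∂P = P.real ({x | i x = a ∧ j x = b} ∩ s) := by
    rw [← h1]
    exact setIntegral_congr_ae (hF _ hs) ((hd a b).mono fun x hx _ => hx.symm)
  rw [Set.inter_comm, ← ofReal_measureReal, ← h2, ofReal_integral_eq_lintegral_ofReal]
  · exact (integrable_condExp.congr (hd a b)).integrableOn
  · exact Filter.Eventually.of_forall fun x => mul_nonneg (hp x a) (hq x b)

lemma sum_sum_mul_eq_one {p : Fin m → ℝ} {q : Fin n → ℝ} (hp : p ∈ stdSimplex ℝ (Fin m))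
    (hq : q ∈ stdSimplex ℝ (Fin n)) : ∑ a, ∑ b, p a * q b = 1 := by
  simp_rw [← Finset.mul_sum, hq.2, mul_one, hp.2]

lemma exp_neg_le_one_sub_half {u : ℝ} (h0 : 0 ≤ u) (h1 : u ≤ 1) : Real.exp (-u) ≤ 1 - u / 2 := by
  rw [Real.exp_neg]
  calc (Real.exp u)⁻¹ ≤ (1 + u)⁻¹ := by
        gcongr
        linarith [Real.add_one_le_exp u]
    _ ≤ 1 - u / 2 := by
        rw [inv_le_iff_one_le_mul₀ (by positivity)]
        nlinarith

/-- Source of the factor `1/4` in `excess`: one half from the exponent, one half from `exp (-u) ≤ 1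
- u/2` on `[0, 1]`, after which `1 - z ≤ exp (-z)`. -/
lemma sum_sum_mul_exp_neg_le {p : Fin m → ℝ} {q : Fin n → ℝ} (hp : p ∈ stdSimplex ℝ (Fin m))
    (hq : q ∈ stdSimplex ℝ (Fin n)) {η : ℝ} (hη : 0 ≤ η) {G : Matrix (Fin m) (Fin n) ℝ}
    (hG : ∀ a b, η * G a b ^ 2 ≤ 2) :
    ∑ a, ∑ b, p a * q b * Real.exp (-(η * G a b ^ 2 / 2))
      ≤ Real.exp (-(η * (1 / 4 * ∑ a, ∑ b, p a * q b * G a b ^ 2))) := by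
  calc _ ≤ ∑ a, ∑ b, p a * q b * (1 - η * G a b ^ 2 / 2 / 2) := by
        gcongr with a _ b _
        · exact mul_nonneg (hp.1 a) (hq.1 b)
        · exact exp_neg_le_one_sub_half (by positivity) (by linarith [hG a b])
    _ = 1 - η * (1 / 4 * ∑ a, ∑ b, p a * q b * G a b ^ 2) := by
        conv_rhs => lhs; rw [← sum_sum_mul_eq_one hp hq]
        simp_rw [Finset.mul_sum, ← Finset.sum_sub_distrib]
        exact Finset.sum_congr rfl fun a _ => Finset.sum_congr rfl fun b _ => by ring
    _ ≤ _ := by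
        linarith [Real.add_one_le_exp (-(η * (1 / 4 * ∑ a, ∑ b, p a * q b * G a b ^ 2)))]

/-- Given the entry, the noise contributes `2η²σ²G² ≤ ηG²/2` to the exponent, as `ησ² ≤ 1/4`. Half
of `-ηG²` therefore survives, and is averaged over the law `p ⊗ q` of the entry. -/
lemma setLIntegral_exp_loss_le (hF : F ≤ mS) (hi : Measurable i) (hj : Measurable j)
    (hy : Measurable y) (hn : SubGaussianFeedback P A σ F i j y) (hd : DrawnFrom P F i j p q)
    (hpm : Measurable p) (hqm : Measurable q)
    (hp : ∀ x, p x ∈ stdSimplex ℝ (Fin m)) (hq : ∀ x, q x ∈ stdSimplex ℝ (Fin n))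
    {η : ℝ} (hη : 0 ≤ η) (hησ : η * σ ^ 2 ≤ 1 / 4) {G : Matrix (Fin m) (Fin n) ℝ}
    (hG : ∀ a b, η * G a b ^ 2 ≤ 2) {s : Set S} (hs : MeasurableSet[F] s) :
    ∫⁻ x in s, ENNReal.ofReal (Real.exp
        (η * (2 * G (i x) (j x) * (y x - A (i x) (j x)) - G (i x) (j x) ^ 2))) ∂P
      ≤ ∫⁻ x in s, ENNReal.ofReal (Real.exp
        (-(η * (1 / 4 * ∑ a, ∑ b, p x a * q x b * G a b ^ 2)))) ∂P := by
  have h3 : ∀ a, Measurable fun x => p x a := fun a => (measurable_pi_apply a).comp hpm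
  have h4 : ∀ b, Measurable fun x => q x b := fun b => (measurable_pi_apply b).comp hqm
  have hsm := hF _ hs
  let E : Fin m → Fin n → Set S := fun a b => {x | i x = a ∧ j x = b}
  have hE : ∀ a b, MeasurableSet (E a b) := measurableSet_entry hi hj
  let Y : Fin m → Fin n → S → ENNReal := fun a b x => ENNReal.ofReal
    (Real.exp (η * (2 * G a b * (y x - A a b) - G a b ^ 2)))
  have hY : ∀ a b, Measurable (Y a b) := fun a b =>
    ((((hy.sub_const _).const_mul _).sub_const _).const_mul _).exp.ennreal_ofReal
  have hYle : ∀ a b, ∫⁻ x in s ∩ E a b, Y a b x ∂P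
      ≤ ENNReal.ofReal (Real.exp (-(η * G a b ^ 2 / 2))) * P (s ∩ E a b) := by
    intro a b
    have h := setLIntegral_exp_noise_le hF hi hj hn hs a b (2 * η * G a b)
    have e : ∀ x, Y a b x = ENNReal.ofReal (Real.exp (-(η * G a b ^ 2))) *
        ENNReal.ofReal (Real.exp (2 * η * G a b * (y x - A a b))) := by
      intro x
      rw [← ENNReal.ofReal_mul (Real.exp_pos _).le, ← Real.exp_add]
      simp only [Y]
      congr 2
      ring
    simp_rw [e]
    rw [lintegral_const_mul _ ((hy.sub_const _).const_mul _).exp.ennreal_ofReal]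
    refine (mul_le_mul_right h _).trans ?_
    rw [← mul_assoc, ← ENNReal.ofReal_mul (Real.exp_pos _).le, ← Real.exp_add]
    refine mul_le_mul_left (ENNReal.ofReal_le_ofReal (Real.exp_le_exp.2 ?_)) _
    have : 0 ≤ η * G a b ^ 2 * (1 / 4 - η * σ ^ 2) :=
      mul_nonneg (by positivity) (by linarith)
    linarith
  calc _ = ∫⁻ x in s, ∑ a, ∑ b, (E a b).indicator (Y a b) x ∂P := by
        refine lintegral_congr fun x => ?_
        rw [Finset.sum_eq_single (i x), Finset.sum_eq_single (j x)]
        · simp [E, Y]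
        · intro b _ hb
          simp [E, hb.symm]
        · simp
        · intro a _ ha
          simp [E, ha.symm]
        · simp
    _ = ∑ a, ∑ b, ∫⁻ x in s ∩ E a b, Y a b x ∂P := by
        have hm : ∀ a b, Measurable ((E a b).indicator (Y a b)) := fun a b =>
          (hY a b).indicator (hE a b)
        have hm' : ∀ a, Measurable fun x => ∑ b, (E a b).indicator (Y a b) x := fun a =>
          Finset.measurable_sum _ fun b _ => hm a b
        rw [lintegral_finsetSum _ fun a _ => hm' a]
        refine Finset.sum_congr rfl fun a _ => ?_
        rw [lintegral_finsetSum _ fun b _ => hm a b]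
        refine Finset.sum_congr rfl fun b _ => ?_
        rw [lintegral_indicator (hE a b), Measure.restrict_restrict (hE a b), Set.inter_comm]
    _ ≤ ∑ a, ∑ b, ∫⁻ x in s, ENNReal.ofReal
          (p x a * q x b * Real.exp (-(η * G a b ^ 2 / 2))) ∂P := by
        refine Finset.sum_le_sum fun a _ => Finset.sum_le_sum fun b _ => (hYle a b).trans ?_
        have hm : Measurable fun x => ENNReal.ofReal (p x a * q x b) :=
          ((h3 a).mul (h4 b)).ennreal_ofReal
        rw [measure_inter_entry_eq hF hi hj hd (fun x => (hp x).1) (fun x => (hq x).1) hs,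
          ← lintegral_const_mul _ hm]
        refine lintegral_mono fun x => ?_
        rw [← ENNReal.ofReal_mul (Real.exp_pos _).le, mul_comm]
    _ = ∫⁻ x in s, ENNReal.ofReal
          (∑ a, ∑ b, p x a * q x b * Real.exp (-(η * G a b ^ 2 / 2))) ∂P := by
        have hnn : ∀ x a b, 0 ≤ p x a * q x b * Real.exp (-(η * G a b ^ 2 / 2)) := fun x a b =>
          mul_nonneg (mul_nonneg ((hp x).1 a) ((hq x).1 b)) (Real.exp_pos _).le
        have hm : ∀ a b, Measurable fun x => ENNReal.ofReal
            (p x a * q x b * Real.exp (-(η * G a b ^ 2 / 2))) := fun a b =>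
          (((h3 a).mul (h4 b)).mul_const _).ennreal_ofReal
        simp_rw [ENNReal.ofReal_sum_of_nonneg fun a _ =>
          Finset.sum_nonneg fun b _ => hnn _ a b,
          ENNReal.ofReal_sum_of_nonneg fun b _ => hnn _ _ b]
        have hm' : ∀ a, Measurable fun x => ∑ b, ENNReal.ofReal
            (p x a * q x b * Real.exp (-(η * G a b ^ 2 / 2))) := fun a =>
          Finset.measurable_sum _ fun b _ => hm a b
        rw [lintegral_finsetSum _ fun a _ => hm' a]
        refine Finset.sum_congr rfl fun a _ => ?_
        rw [lintegral_finsetSum _ fun b _ => hm a b]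
    _ ≤ _ := lintegral_mono fun x => ENNReal.ofReal_le_ofReal
        (sum_sum_mul_exp_neg_le (hp x) (hq x) hη hG)

/-- One step of the exponential supermartingale. -/
lemma lintegral_mul_exp_excess_le (hF : F ≤ mS) (hi : Measurable i) (hj : Measurable j)
    (hy : Measurable y) (hn : SubGaussianFeedback P A σ F i j y) (hd : DrawnFrom P F i j p q)
    (hpm : Measurable[F] p) (hqm : Measurable[F] q)
    (hp : ∀ x, p x ∈ stdSimplex ℝ (Fin m)) (hq : ∀ x, q x ∈ stdSimplex ℝ (Fin n))
    {η : ℝ} (hη : 0 ≤ η) (hησ : η * σ ^ 2 ≤ 1 / 4) {G : Matrix (Fin m) (Fin n) ℝ}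
    (hG : ∀ a b, η * G a b ^ 2 ≤ 2) {Z : S → ENNReal} (hZ : Measurable[F] Z) :
    ∫⁻ x, Z x * ENNReal.ofReal (Real.exp
        (η * excess A G (i x) (j x) (y x) (p x) (q x))) ∂P ≤ ∫⁻ x, Z x ∂P := by
  let Q : S → ℝ := fun x => η * (1 / 4 * ∑ a, ∑ b, p x a * q x b * G a b ^ 2)
  have hQ : Measurable[F] Q := by
    have h3 : ∀ a, Measurable[F] fun x => p x a := fun a => (measurable_pi_apply a).comp hpm
    have h4 : ∀ b, Measurable[F] fun x => q x b := fun b => (measurable_pi_apply b).comp hqm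
    refine Measurable.const_mul (Measurable.const_mul ?_ _) _
    exact Finset.measurable_sum _ fun a _ => Finset.measurable_sum _ fun b _ =>
      ((h3 a).mul (h4 b)).mul_const _
  have hQm : Measurable Q := hQ.mono hF le_rfl
  let Y : S → ENNReal := fun x => ENNReal.ofReal (Real.exp
    (η * (2 * G (i x) (j x) * (y x - A (i x) (j x)) - G (i x) (j x) ^ 2)))
  have hY : Measurable Y := by
    have h1 := measurable_entry hi hj G
    have h2 := measurable_entry hi hj A
    exact ((((h1.const_mul 2).mul (hy.sub h2)).sub (h1.pow_const 2)).const_mul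
      η).exp.ennreal_ofReal
  let H : S → ENNReal := fun x => ENNReal.ofReal (Real.exp (Q x))
  let H' : S → ENNReal := fun x => ENNReal.ofReal (Real.exp (-Q x))
  have hH : Measurable[F] H := hQ.exp.ennreal_ofReal
  have hH' : Measurable H' := hQm.neg.exp.ennreal_ofReal
  -- The conditional inequality is expressed by comparing measures on `F`. It can then be integrated
  -- against any `F`-measurable weight in `ENNReal`, without integrability conditions.
  have hle : (P.withDensity Y).trim hF ≤ (P.withDensity H').trim hF := by
    refine Measure.le_iff.2 fun s hs => ?_
    rw [trim_measurableSet_eq hF hs, trim_measurableSet_eq hF hs, withDensity_apply _ (hF _ hs),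
      withDensity_apply _ (hF _ hs)]
    exact setLIntegral_exp_loss_le hF hi hj hy hn hd (hpm.mono hF le_rfl)
      (hqm.mono hF le_rfl) hp hq hη hησ hG hs
  have hZH : Measurable[F] fun x => Z x * H x := hZ.mul hH
  have hZHm : Measurable fun x => Z x * H x := hZH.mono hF le_rfl
  calc _ = ∫⁻ x, Y x * (Z x * H x) ∂P := by
        refine lintegral_congr fun x => ?_
        rw [mul_left_comm, ← ENNReal.ofReal_mul (Real.exp_pos _).le, ← Real.exp_add]
        congr 3
        simp only [excess, Q]
        ring
    _ = ∫⁻ x, Z x * H x ∂(P.withDensity Y) :=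
        (lintegral_withDensity_eq_lintegral_mul _ hY hZHm).symm
    _ = ∫⁻ x, Z x * H x ∂((P.withDensity Y).trim hF) := (lintegral_trim hF hZH).symm
    _ ≤ ∫⁻ x, Z x * H x ∂((P.withDensity H').trim hF) := lintegral_mono' hle le_rfl
    _ = ∫⁻ x, Z x * H x ∂(P.withDensity H') := lintegral_trim hF hZH
    _ = ∫⁻ x, H' x * (Z x * H x) ∂P := lintegral_withDensity_eq_lintegral_mul _ hH' hZHm
    _ = _ := by
        refine lintegral_congr fun x => ?_
        rw [mul_left_comm, ← ENNReal.ofReal_mul (Real.exp_pos _).le, ← Real.exp_add]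
        simp

lemma lintegral_exp_noise_le (hF : F ≤ mS) (hi : Measurable i) (hj : Measurable j)
    (hn : SubGaussianFeedback P A σ F i j y) (l : ℝ) :
    ∫⁻ x, ENNReal.ofReal (Real.exp (l * (y x - A (i x) (j x)))) ∂P
      ≤ ENNReal.ofReal (Real.exp (l ^ 2 * σ ^ 2 / 2)) := by
  obtain ⟨hint, hle⟩ := hn l
  have hG : F ⊔ MeasurableSpace.comap (fun x => (i x, j x)) ⊤ ≤ mS := by
    refine sup_le hF ?_
    have := (hi.prodMk hj).comap_le
    rwa [show (Prod.instMeasurableSpace : MeasurableSpace (Fin m × Fin n)) = ⊤ from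
      eq_top_iff.2 fun s _ => s.to_countable.measurableSet] at this
  rw [← ofReal_integral_eq_lintegral_ofReal hint
    (Filter.Eventually.of_forall fun _ => (Real.exp_pos _).le), ← integral_condExp hG]
  refine ENNReal.ofReal_le_ofReal ?_
  refine (integral_mono_ae integrable_condExp (integrable_const _) hle).trans ?_
  simp

/-- Chernoff at `l = ±1/D`, where `σ ≤ D` keeps the moment below `exp (1/2)`. This crude tail serves
only to pass from the net to all of `Θ`. -/
lemma measure_abs_noise_ge_le (hF : F ≤ mS) (hi : Measurable i) (hj : Measurable j)
    (hy : Measurable y) (hn : SubGaussianFeedback P A σ F i j y) {D : ℝ} (hσ : 0 ≤ σ)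
    (hσD : σ ≤ D) (hD : 0 < D) (v : ℝ) :
    P {x | D * v ≤ |y x - A (i x) (j x)|} ≤ ENNReal.ofReal (2 * Real.exp (1 / 2 - v)) := by
  have hm : Measurable fun x => y x - A (i x) (j x) := hy.sub (measurable_entry hi hj A)
  have key : ∀ l : ℝ, l ^ 2 = 1 →
      P {x | v ≤ l / D * (y x - A (i x) (j x))} ≤ ENNReal.ofReal (Real.exp (1 / 2 - v)) := by
    intro l hl
    refine measure_ge_le_exp_neg (hm.const_mul _) ?_ v
    refine (lintegral_exp_noise_le hF hi hj hn _).trans ?_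
    refine ENNReal.ofReal_le_ofReal (Real.exp_le_exp.2 ?_)
    rw [div_pow, hl, one_div, inv_mul_eq_div]
    gcongr
    rw [div_le_one (by positivity)]
    gcongr
  have hsub : {x | D * v ≤ |y x - A (i x) (j x)|} ⊆
      {x | v ≤ 1 / D * (y x - A (i x) (j x))} ∪ {x | v ≤ -1 / D * (y x - A (i x) (j x))} := by
    intro x hx
    simp only [Set.mem_ofPred_eq, Set.mem_union] at hx ⊢
    rw [one_div, neg_div, one_div, inv_mul_eq_div, neg_mul, inv_mul_eq_div, ← neg_div,
      le_div_iff₀ hD, le_div_iff₀ hD, mul_comm v D]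
    rcases abs_cases (y x - A (i x) (j x)) with ⟨h, _⟩ | ⟨h, _⟩
    · exact Or.inl (h ▸ hx)
    · exact Or.inr (h ▸ hx)
  refine (measure_mono hsub).trans ((measure_union_le _ _).trans ?_)
  refine (add_le_add (key 1 (by norm_num)) (key (-1) (by norm_num))).trans ?_
  rw [← ENNReal.ofReal_add (Real.exp_pos _).le (Real.exp_pos _).le, two_mul]

end OneRound

/-! ### The exponential supermartingale over many rounds. -/

/-- `T` rounds of adaptive queries of entries of `A`, with noisy feedback. -/
structure Feedback {S : Type*} [mS : MeasurableSpace S] {m n : ℕ} (P : Measure S)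
    (A : Matrix (Fin m) (Fin n) ℝ) (σ : ℝ) (T : ℕ) where
  ℱ : Filtration ℕ mS
  i : ℕ → S → Fin m
  j : ℕ → S → Fin n
  y : ℕ → S → ℝ
  p : ℕ → S → Fin m → ℝ
  q : ℕ → S → Fin n → ℝ
  measurable_i : ∀ k < T, Measurable[ℱ (k + 1)] (i k)
  measurable_j : ∀ k < T, Measurable[ℱ (k + 1)] (j k)
  measurable_y : ∀ k < T, Measurable[ℱ (k + 1)] (y k)
  measurable_p : ∀ k < T, Measurable[ℱ k] (p k)
  measurable_q : ∀ k < T, Measurable[ℱ k] (q k)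
  p_mem : ∀ k < T, ∀ x, p k x ∈ stdSimplex ℝ (Fin m)
  q_mem : ∀ k < T, ∀ x, q k x ∈ stdSimplex ℝ (Fin n)
  draw : ∀ k < T, DrawnFrom P (ℱ k) (i k) (j k) (p k) (q k)
  noise : ∀ k < T, SubGaussianFeedback P A σ (ℱ k) (i k) (j k) (y k)

namespace Feedback

variable {S : Type*} [mS : MeasurableSpace S] {m n : ℕ} {P : Measure S}
  {A : Matrix (Fin m) (Fin n) ℝ} {σ : ℝ} {T : ℕ} (r : Feedback P A σ T)

/-- Cumulative excess of the first `k` rounds. -/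
noncomputable def totalExcess (G : Matrix (Fin m) (Fin n) ℝ) (k : ℕ) (x : S) : ℝ :=
  ∑ s ∈ Finset.range k, excess A G (r.i s x) (r.j s x) (r.y s x) (r.p s x) (r.q s x)

lemma measurable_totalExcess (G : Matrix (Fin m) (Fin n) ℝ) {k : ℕ} (hk : k ≤ T) :
    Measurable[r.ℱ k] (r.totalExcess G k) := by
  refine Finset.measurable_sum _ fun s hs => ?_
  have hsk : s + 1 ≤ k := Finset.mem_range.1 hs
  have hsT : s < T := by omega
  have h1 := r.ℱ.mono hsk
  have h0 := r.ℱ.mono (Nat.le_of_succ_le hsk)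
  exact @measurable_excess S m n (r.ℱ k) _ _ _ _ _ ((r.measurable_i s hsT).mono h1 le_rfl)
    ((r.measurable_j s hsT).mono h1 le_rfl) ((r.measurable_y s hsT).mono h1 le_rfl)
    ((r.measurable_p s hsT).mono h0 le_rfl) ((r.measurable_q s hsT).mono h0 le_rfl) A G

variable [IsProbabilityMeasure P]

lemma lintegral_exp_totalExcess_le {η : ℝ} (hη : 0 ≤ η) (hησ : η * σ ^ 2 ≤ 1 / 4)
    {G : Matrix (Fin m) (Fin n) ℝ} (hG : ∀ a b, η * G a b ^ 2 ≤ 2) {k : ℕ} (hk : k ≤ T) :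
    ∫⁻ x, ENNReal.ofReal (Real.exp (η * r.totalExcess G k x)) ∂P ≤ 1 := by
  induction k with
  | zero => simp [totalExcess]
  | succ k ih =>
    have hkT : k < T := hk
    have hle := r.ℱ.le (k + 1)
    refine le_trans ?_ (ih hkT.le)
    refine le_trans (le_of_eq ?_) (lintegral_mul_exp_excess_le (r.ℱ.le k)
      ((r.measurable_i k hkT).mono hle le_rfl) ((r.measurable_j k hkT).mono hle le_rfl)
      ((r.measurable_y k hkT).mono hle le_rfl) (r.noise k hkT) (r.draw k hkT)
      (r.measurable_p k hkT) (r.measurable_q k hkT) (r.p_mem k hkT) (r.q_mem k hkT) hη hησ hG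
      ((r.measurable_totalExcess G hkT.le).const_mul η).exp.ennreal_ofReal)
    refine lintegral_congr fun x => ?_
    rw [← ENNReal.ofReal_mul (Real.exp_pos _).le, ← Real.exp_add, ← mul_add]
    simp [totalExcess, Finset.sum_range_succ]

lemma measure_totalExcess_ge_le {η : ℝ} (hη : 0 ≤ η) (hησ : η * σ ^ 2 ≤ 1 / 4)
    {G : Matrix (Fin m) (Fin n) ℝ} (hG : ∀ a b, η * G a b ^ 2 ≤ 2) {k : ℕ} (hk : k ≤ T) (u : ℝ) :
    P {x | u ≤ η * r.totalExcess G k x} ≤ ENNReal.ofReal (Real.exp (-u)) := by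
  have := measure_ge_le_exp_neg (P := P) (X := fun x => η * r.totalExcess G k x) (c := 0)
    (((r.measurable_totalExcess G hk).mono (r.ℱ.le k) le_rfl).const_mul η)
    (by simpa using r.lintegral_exp_totalExcess_le hη hησ hG hk) u
  simpa using this

end Feedback

/-! ### Covering the parameter set, and the complexity term. -/

/-- A finite `1/T`-net, inside the set, of a subset of the ball of radius `√d`. -/
lemma exists_net {d T : ℕ} (hd : 1 ≤ d) (hT : 1 ≤ T) {Θ : Set (EuclideanSpace ℝ (Fin d))}
    (hΘ : Θ ⊆ Metric.closedBall 0 √d) :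
    ∃ N : Finset (EuclideanSpace ℝ (Fin d)), (N : Set _) ⊆ Θ ∧
      (N.card : ℝ) ≤ (2 * √d * (d * T) + 2) ^ d ∧ ∀ ω ∈ Θ, ∃ ω' ∈ N, ‖ω - ω'‖ ≤ 1 / T := by
  have hd0 : (1 : ℝ) ≤ d := by exact_mod_cast hd
  have hT0 : (1 : ℝ) ≤ T := by exact_mod_cast hT
  set M : ℝ := d * T with hM
  have hM0 : 0 < M := by positivity
  -- Cells of side `1/(dT)`: points of one cell are within `√d/(dT) ≤ 1/T`. One representative of
  -- each cell met by `Θ` is kept, so the net stays inside `Θ`, where payoffs are bounded.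
  let f : EuclideanSpace ℝ (Fin d) → (Fin d → ℤ) := fun ω c => ⌊ω c * M⌋
  let box : Finset (Fin d → ℤ) := Fintype.piFinset fun _ => Finset.Icc ⌊-(√d * M)⌋ ⌊√d * M⌋
  have hbox : ∀ ω ∈ Θ, f ω ∈ box := by
    intro ω hω
    refine Fintype.mem_piFinset.2 fun c => Finset.mem_Icc.2 ?_
    have h1 : |ω c| ≤ √d := by
      have := (PiLp.norm_apply_le ω c).trans (mem_closedBall_zero_iff.1 (hΘ hω))
      rwa [Real.norm_eq_abs] at this
    obtain ⟨h2, h3⟩ := abs_le.1 h1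
    constructor
    · refine Int.floor_le_floor ?_
      rw [← neg_mul]
      gcongr
    · exact Int.floor_le_floor (by gcongr)
  obtain ⟨N, hNΘ, hbij⟩ := Set.exists_subset_bijOn Θ f
  have himg : f '' Θ ⊆ box := by
    rintro _ ⟨ω, hω, rfl⟩
    exact hbox ω hω
  have hfin : N.Finite := by
    refine Set.Finite.of_finite_image ?_ hbij.injOn
    rw [hbij.image_eq]
    exact box.finite_toSet.subset himg
  refine ⟨hfin.toFinset, by simpa using hNΘ, ?_, ?_⟩
  · have h1 : hfin.toFinset.card ≤ box.card := by
      refine Finset.card_le_card_of_injOn f (fun ω hω => hbox ω (hNΘ (by simpa using hω))) ?_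
      simpa using hbij.injOn
    have h2 : (box.card : ℝ) ≤ (2 * √d * M + 2) ^ d := by
      simp only [box, Fintype.card_piFinset, Int.card_Icc, Finset.prod_const, Finset.card_univ,
        Fintype.card_fin, Nat.cast_pow]
      gcongr
      have h3 : ⌊-(√d * M)⌋ ≤ ⌊√d * M⌋ := by
        refine Int.floor_le_floor ?_
        have : 0 ≤ √d * M := by positivity
        linarith
      have h4 : (((⌊√d * M⌋ + 1 - ⌊-(√d * M)⌋).toNat : ℤ) : ℝ)
          = (⌊√d * M⌋ + 1 - ⌊-(√d * M)⌋ : ℝ) := by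
        rw [Int.toNat_of_nonneg (by omega)]
        push_cast
        ring
      rw [Int.cast_natCast] at h4
      rw [h4]
      linarith [Int.floor_le (√d * M), Int.lt_floor_add_one (-(√d * M))]
    exact (Nat.cast_le.2 h1).trans h2
  · intro ω hω
    obtain ⟨ω', hω', hf⟩ := hbij.surjOn ⟨ω, hω, rfl⟩
    refine ⟨ω', by simpa using hω', ?_⟩
    have hc : ∀ c, (ω c - ω' c) ^ 2 ≤ (1 / M) ^ 2 := by
      intro c
      have h1 : ⌊ω' c * M⌋ = ⌊ω c * M⌋ := congrFun hf c
      have h2 : |ω c * M - ω' c * M| < 1 := Int.abs_sub_lt_one_of_floor_eq_floor h1.symm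
      rw [← sub_mul, abs_mul, abs_of_pos hM0] at h2
      rw [← sq_abs]
      gcongr
      rw [le_div_iff₀ hM0]
      exact h2.le
    rw [EuclideanSpace.norm_eq]
    refine Real.sqrt_le_iff.2 ⟨by positivity, ?_⟩
    calc _ ≤ ∑ _c : Fin d, (1 / M) ^ 2 := Finset.sum_le_sum fun c _ => by
          simpa using hc c
      _ = d * (1 / M) ^ 2 := by simp
      _ ≤ d ^ 2 * (1 / M) ^ 2 := by
          gcongr
          nlinarith
      _ = (1 / T) ^ 2 := by
          rw [hM]
          field_simp

/-- The complexity term `log (4T/δ) + d log (1 + 2√d T)`. -/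
noncomputable def complexity (d T : ℕ) (δ : ℝ) : ℝ :=
  Real.log (4 * T / δ) + d * Real.log (1 + 2 * √d * T)

lemma one_le_log_four_mul_div {T : ℕ} (hT : 1 ≤ T) {δ : ℝ} (hδ : 0 < δ) (hδ1 : δ < 1) :
    1 ≤ Real.log (4 * T / δ) := by
  have hT0 : (1 : ℝ) ≤ T := by exact_mod_cast hT
  rw [Real.le_log_iff_exp_le (by positivity), le_div_iff₀ hδ]
  have := Real.exp_one_lt_d9
  nlinarith [Real.exp_pos 1]

lemma one_le_log_one_add_two_mul {d T : ℕ} (hd : 1 ≤ d) (hT : 1 ≤ T) :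
    1 ≤ Real.log (1 + 2 * √d * T) := by
  have hT0 : (1 : ℝ) ≤ T := by exact_mod_cast hT
  have hd0 : (1 : ℝ) ≤ √d := Real.one_le_sqrt.2 (by exact_mod_cast hd)
  rw [Real.le_log_iff_exp_le (by positivity)]
  have := Real.exp_one_lt_d9
  nlinarith

lemma one_le_complexity {d T : ℕ} (hd : 1 ≤ d) (hT : 1 ≤ T) {δ : ℝ} (hδ : 0 < δ) (hδ1 : δ < 1) :
    1 ≤ complexity d T δ := by
  have h1 := one_le_log_four_mul_div hT hδ hδ1
  have h2 := one_le_log_one_add_two_mul hd hT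
  unfold complexity
  have : 0 ≤ (d : ℝ) * Real.log (1 + 2 * √d * T) := by positivity
  linarith

/-! ### Uniform concentration over the parameter set. -/

section Excess

variable {m n : ℕ} {A G G' : Matrix (Fin m) (Fin n) ℝ} {p : Fin m → ℝ} {q : Fin n → ℝ}

/-- Squares of entries differ by at most `4Bε`; this enters once directly and once with weight
`1/4`, whence `5Bε`. The rest is the noise term. -/
lemma excess_le_excess_add (hp : p ∈ stdSimplex ℝ (Fin m)) (hq : q ∈ stdSimplex ℝ (Fin n))
    {B ε w : ℝ} (hB : 0 ≤ B) (hG : ∀ a b, |G a b| ≤ 2 * B) (hG' : ∀ a b, |G' a b| ≤ 2 * B)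
    (hε : ∀ a b, |G a b - G' a b| ≤ ε) (a : Fin m) (b : Fin n) {y : ℝ} (hy : |y - A a b| ≤ w) :
    excess A G a b y p q ≤ excess A G' a b y p q + (2 * ε * w + 5 * B * ε) := by
  have hε0 : 0 ≤ ε := (abs_nonneg _).trans (hε a b)
  have hsq : ∀ a b, |G a b ^ 2 - G' a b ^ 2| ≤ 4 * B * ε := by
    intro a b
    rw [sq_sub_sq, abs_mul]
    have h1 : |G a b + G' a b| ≤ 4 * B :=
      (abs_add_le _ _).trans (by linarith [hG a b, hG' a b])
    exact mul_le_mul h1 (hε a b) (abs_nonneg _) (by positivity)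
  have h1 : (G a b - G' a b) * (y - A a b) ≤ ε * w := by
    refine (le_abs_self _).trans ?_
    rw [abs_mul]
    exact mul_le_mul (hε a b) hy (abs_nonneg _) hε0
  have h2 := (abs_le.1 (hsq a b)).1
  have h3 : ∑ a, ∑ b, p a * q b * G a b ^ 2 ≤ ∑ a, ∑ b, p a * q b * G' a b ^ 2 + 4 * B * ε := by
    have : 4 * B * ε = ∑ a, ∑ b, p a * q b * (4 * B * ε) := by
      simp_rw [← Finset.sum_mul]
      rw [sum_sum_mul_eq_one hp hq, one_mul]
    rw [this, ← Finset.sum_add_distrib]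
    refine Finset.sum_le_sum fun a _ => ?_
    rw [← Finset.sum_add_distrib]
    refine Finset.sum_le_sum fun b _ => ?_
    rw [← mul_add]
    refine mul_le_mul_of_nonneg_left ?_ (mul_nonneg (hp.1 a) (hq.1 b))
    linarith [(abs_le.1 (hsq a b)).2]
  unfold excess
  linarith

end Excess

lemma abs_payoff_sub_le {m n d : ℕ} {φ : Fin m → Fin n → EuclideanSpace ℝ (Fin d)}
    (hφ : ∀ i j, ‖φ i j‖ ≤ 1) (ω ω' : EuclideanSpace ℝ (Fin d)) (a : Fin m) (b : Fin n) :
    |payoff φ ω a b - payoff φ ω' a b| ≤ ‖ω - ω'‖ := by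
  simp only [payoff, Matrix.of_apply, ← inner_sub_right]
  refine (abs_real_inner_le_norm _ _).trans ?_
  have := mul_le_mul_of_nonneg_right (hφ a b) (norm_nonneg (ω - ω'))
  linarith

lemma log_net_card_le {d T : ℕ} (hd : 1 ≤ d) (hT : 1 ≤ T) :
    Real.log ((2 * √d * (d * T) + 2) ^ d) ≤ 3 * (d * Real.log (1 + 2 * √d * T)) := by
  have hT0 : (1 : ℝ) ≤ T := by exact_mod_cast hT
  have hd0 : (1 : ℝ) ≤ √d := Real.one_le_sqrt.2 (by exact_mod_cast hd)
  have h : 2 * √d * (d * T) + 2 ≤ (1 + 2 * √d * T) ^ 3 := by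
    have h1 : (d : ℝ) = √d ^ 2 := (Real.sq_sqrt (Nat.cast_nonneg d)).symm
    set s := √d
    rw [h1]
    have h3 : s ^ 3 * T ≤ (s * T) ^ 3 := by
      rw [mul_pow]
      gcongr
      exact le_self_pow₀ hT0 (by norm_num)
    have h4 : 1 ≤ s * T := by nlinarith
    have : (1 + 2 * s * T) ^ 3 = 1 + 6 * (s * T) + 12 * (s * T) ^ 2 + 8 * (s * T) ^ 3 := by ring
    nlinarith [sq_nonneg (s * T)]
  rw [Real.log_pow]
  have := Real.log_le_log (by positivity) h
  rw [Real.log_pow] at this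
  push_cast at this
  nlinarith [(Nat.cast_nonneg d : (0 : ℝ) ≤ d)]

namespace Feedback

variable {S : Type*} [mS : MeasurableSpace S] {m n d : ℕ} {P : Measure S} [IsProbabilityMeasure P]
  {A : Matrix (Fin m) (Fin n) ℝ} {σ : ℝ} {T : ℕ} (r : Feedback P A σ T)

/-- Uniform concentration of the squared loss over the parameter set. -/
theorem exists_event (hd : 1 ≤ d) (hT : 1 ≤ T) {φ : Fin m → Fin n → EuclideanSpace ℝ (Fin d)}
    (hφ : ∀ i j, ‖φ i j‖ ≤ 1) {Θ : Set (EuclideanSpace ℝ (Fin d))}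
    (hΘ : Θ ⊆ Metric.closedBall 0 √d) {B δ : ℝ} (hB0 : 0 ≤ B)
    (hB : ∀ ω ∈ Θ, ∀ i j, |payoff φ ω i j| ≤ B) (hreal : ∃ ω ∈ Θ, payoff φ ω = A)
    (hσ : 0 ≤ σ) (hδ : 0 < δ) (hδ1 : δ < 1) :
    ∃ E : Set S, P E ≤ ENNReal.ofReal (δ / 2) ∧ ∀ x ∉ E, ∀ k < T, ∀ ω ∈ Θ,
      r.totalExcess (payoff φ ω - A) k x ≤ 23 * (1 + B + σ) ^ 2 * complexity d T δ := by
  obtain ⟨ω₁, hω₁, hA⟩ := hreal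
  obtain ⟨N, hNΘ, hNcard, hN⟩ := exists_net hd hT hΘ
  have hT0 : (1 : ℝ) ≤ T := by exact_mod_cast hT
  set D := 1 + B + σ with hD
  have hD1 : 1 ≤ D := by linarith
  have hN0 : 0 < N.card := by
    obtain ⟨ω', h, -⟩ := hN ω₁ hω₁
    exact Finset.card_pos.2 ⟨ω', h⟩
  have hN1 : (1 : ℝ) ≤ N.card := by exact_mod_cast hN0
  -- The levels `u` and `v` make the two union bounds, over rounds and net points and over rounds
  -- alone, equal to `δ/4` each. The choice of `η` ensures `ησ² ≤ 1/4` and, since deviations are at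
  -- most `2B`, `ηG² ≤ 2`.
  set u := Real.log (4 * T * N.card / δ) with hu
  set v := Real.log (4 * T / δ) + Real.log 2 + 1 / 2 with hv
  set η : ℝ := 1 / (4 * D ^ 2) with hη
  have hη0 : 0 < η := by positivity
  have hG : ∀ ω ∈ Θ, ∀ a b, |(payoff φ ω - A) a b| ≤ 2 * B := by
    intro ω hω a b
    rw [Matrix.sub_apply, ← hA]
    exact (abs_sub _ _).trans (by linarith [hB ω hω a b, hB ω₁ hω₁ a b])
  have hηG : ∀ ω ∈ Θ, ∀ a b, η * (payoff φ ω - A) a b ^ 2 ≤ 2 := by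
    intro ω hω a b
    have h1 : (payoff φ ω - A) a b ^ 2 ≤ (2 * D) ^ 2 := by
      rw [← sq_abs]
      gcongr
      exact (hG ω hω a b).trans (by linarith)
    rw [hη, one_div, inv_mul_le_iff₀ (by positivity)]
    nlinarith
  have hησ : η * σ ^ 2 ≤ 1 / 4 := by
    have h1 : σ ^ 2 ≤ D ^ 2 := by
      gcongr
      linarith
    rw [hη, one_div, inv_mul_le_iff₀ (by positivity)]
    linarith
  let E₁ : Set S := ⋃ k ∈ Finset.range T, ⋃ ω ∈ N,
    {x | u ≤ η * r.totalExcess (payoff φ ω - A) k x}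
  let E₂ : Set S := ⋃ k ∈ Finset.range T, {x | D * v ≤ |r.y k x - A (r.i k x) (r.j k x)|}
  have hE₁ : P E₁ ≤ ENNReal.ofReal (δ / 4) := by
    calc P E₁ ≤ ∑ k ∈ Finset.range T, ∑ ω ∈ N, ENNReal.ofReal (Real.exp (-u)) := by
          refine (measure_biUnion_finset_le _ _).trans (Finset.sum_le_sum fun k hk => ?_)
          refine (measure_biUnion_finset_le _ _).trans (Finset.sum_le_sum fun ω hω => ?_)
          exact r.measure_totalExcess_ge_le hη0.le hησ (hηG ω (hNΘ hω))
            (Finset.mem_range.1 hk).le u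
      _ = ENNReal.ofReal (T * (N.card * Real.exp (-u))) := by
          rw [ENNReal.ofReal_mul (by positivity), ENNReal.ofReal_mul (by positivity)]
          simp
      _ = ENNReal.ofReal (δ / 4) := by
          congr 1
          rw [hu, Real.exp_neg, Real.exp_log (by positivity)]
          field_simp
  have hE₂ : P E₂ ≤ ENNReal.ofReal (δ / 4) := by
    calc P E₂ ≤ ∑ k ∈ Finset.range T, ENNReal.ofReal (2 * Real.exp (1 / 2 - v)) := by
          refine (measure_biUnion_finset_le _ _).trans (Finset.sum_le_sum fun k hk => ?_)
          have hkT := Finset.mem_range.1 hk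
          have hle := r.ℱ.le (k + 1)
          exact measure_abs_noise_ge_le (r.ℱ.le k) ((r.measurable_i k hkT).mono hle le_rfl)
            ((r.measurable_j k hkT).mono hle le_rfl) ((r.measurable_y k hkT).mono hle le_rfl)
            (r.noise k hkT) hσ (by linarith) (by linarith) v
      _ = ENNReal.ofReal (T * (2 * Real.exp (1 / 2 - v))) := by
          rw [ENNReal.ofReal_mul (by positivity)]
          simp
      _ = ENNReal.ofReal (δ / 4) := by
          congr 1
          have : 1 / 2 - v = -(Real.log (4 * T / δ) + Real.log 2) := by
            rw [hv]
            ring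
          rw [this, Real.exp_neg, Real.exp_add, Real.exp_log (by positivity),
            Real.exp_log (by norm_num)]
          field_simp
  refine ⟨E₁ ∪ E₂, ?_, ?_⟩
  · refine (measure_union_le _ _).trans ((add_le_add hE₁ hE₂).trans ?_)
    rw [← ENNReal.ofReal_add (by positivity) (by positivity)]
    exact ENNReal.ofReal_le_ofReal (by linarith)
  intro x hx k hk ω hω
  simp only [E₁, E₂, Set.mem_union, Set.mem_iUnion, Set.mem_ofPred_eq, Finset.mem_range, not_or,
    not_exists, not_le] at hx
  obtain ⟨hx₁, hx₂⟩ := hx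
  obtain ⟨ω', hω', hdist⟩ := hN ω hω
  have hL := one_le_log_four_mul_div hT hδ hδ1
  have hC : 0 ≤ (d : ℝ) * Real.log (1 + 2 * √d * T) := by
    have := one_le_log_one_add_two_mul hd hT
    positivity
  have hCeq : complexity d T δ = Real.log (4 * T / δ) + d * Real.log (1 + 2 * √d * T) := rfl
  have hu3 : u ≤ 3 * complexity d T δ := by
    have h1 : u = Real.log (4 * T / δ) + Real.log N.card := by
      rw [hu, ← Real.log_mul (by positivity) (by positivity)]
      congr 1
      ring
    have h2 := (Real.log_le_log (by positivity) hNcard).trans (log_net_card_le hd hT)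
    linarith
  have hv3 : v ≤ 3 * complexity d T δ := by
    have := Real.log_two_lt_d9
    linarith
  have hv0 : 0 ≤ v := by
    have := Real.log_pos one_lt_two
    linarith
  have h1 : r.totalExcess (payoff φ ω' - A) k x ≤ 4 * D ^ 2 * u := by
    have := (hx₁ k hk ω' hω').le
    rw [hη, one_div, inv_mul_le_iff₀ (by positivity)] at this
    exact this
  -- The net error is of order `1/T` per round and there are fewer than `T` rounds, so its total
  -- does not grow with `T` except through `v`.
  have h2 : r.totalExcess (payoff φ ω - A) k x ≤ r.totalExcess (payoff φ ω' - A) k x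
      + (2 * (D * v) + 5 * B) := by
    calc r.totalExcess (payoff φ ω - A) k x
        ≤ ∑ s ∈ Finset.range k, (excess A (payoff φ ω' - A) (r.i s x) (r.j s x) (r.y s x)
            (r.p s x) (r.q s x) + (2 * (1 / T) * (D * v) + 5 * B * (1 / T))) := by
          refine Finset.sum_le_sum fun s hs => ?_
          have hsT : s < T := (Finset.mem_range.1 hs).trans hk
          refine excess_le_excess_add (r.p_mem s hsT x) (r.q_mem s hsT x) hB0 (hG ω hω)
            (hG ω' (hNΘ hω')) (fun a b => ?_) _ _ (hx₂ s hsT).le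
          rw [Matrix.sub_apply, Matrix.sub_apply, sub_sub_sub_cancel_right]
          exact (abs_payoff_sub_le hφ ω ω' a b).trans hdist
      _ = r.totalExcess (payoff φ ω' - A) k x + k / T * (2 * (D * v) + 5 * B) := by
          rw [Finset.sum_add_distrib, totalExcess]
          simp only [Finset.sum_const, Finset.card_range, nsmul_eq_mul]
          ring
      _ ≤ _ := by
          have h3 : (k : ℝ) / T ≤ 1 := by
            rw [div_le_one (by positivity)]
            exact_mod_cast hk.le
          have h4 : 0 ≤ 2 * (D * v) + 5 * B := by positivity
          nlinarith
  have hC1 : 1 ≤ complexity d T δ := by linarith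
  have hD2 : D ≤ D ^ 2 := by nlinarith
  -- The constant is `23 = 12 + 6 + 5`.
  calc _ ≤ 4 * D ^ 2 * u + (2 * (D * v) + 5 * B) := by linarith
    _ ≤ 4 * D ^ 2 * (3 * complexity d T δ) + (2 * (D ^ 2 * (3 * complexity d T δ))
        + 5 * (D ^ 2 * complexity d T δ)) := by
        gcongr
        have : B ≤ D ^ 2 := by linarith
        exact this.trans (le_mul_of_one_le_right (by positivity) hC1)
    _ = _ := by ring

end Feedback

/-! ### Mean features, values and duality gaps. -/

section Game

variable {m n d : ℕ} {R : Reg m n} {φ : Fin m → Fin n → EuclideanSpace ℝ (Fin d)}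
  {p : Fin m → ℝ} {q : Fin n → ℝ}

open Matrix in
lemma payoff_sub_payoff (ω ω' : EuclideanSpace ℝ (Fin d)) (a : Fin m) (b : Fin n) :
    payoff φ ω a b - payoff φ ω' a b = (φ a b).ofLp ⬝ᵥ (ω - ω').ofLp := by
  simp only [payoff, Matrix.of_apply, ← inner_sub_right]
  rw [EuclideanSpace.inner_eq_star_dotProduct, star_trivial, dotProduct_comm]

/-- The expected feature vector under the product policy `p ⊗ q`. -/
def meanFeature (φ : Fin m → Fin n → EuclideanSpace ℝ (Fin d)) (p : Fin m → ℝ) (q : Fin n → ℝ) :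
    Fin d → ℝ :=
  ∑ a, ∑ b, (p a * q b) • (φ a b).ofLp

open Matrix in
lemma meanFeature_dotProduct (v : Fin d → ℝ) :
    meanFeature φ p q ⬝ᵥ v = ∑ a, ∑ b, p a * q b * ((φ a b).ofLp ⬝ᵥ v) := by
  simp [meanFeature, sum_dotProduct, smul_dotProduct]

-- Jensen's inequality for the law `p ⊗ q`. It lets the expected squared deviations of entries
-- control the errors in mean-feature directions.
open Matrix in
lemma meanFeature_dotProduct_sq_le (hp : p ∈ stdSimplex ℝ (Fin m))
    (hq : q ∈ stdSimplex ℝ (Fin n)) (v : Fin d → ℝ) :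
    (meanFeature φ p q ⬝ᵥ v) ^ 2 ≤ ∑ a, ∑ b, p a * q b * ((φ a b).ofLp ⬝ᵥ v) ^ 2 := by
  rw [meanFeature_dotProduct]
  have h := Finset.sum_sq_le_sum_mul_sum_of_sq_le_mul
    (Finset.univ : Finset (Fin m × Fin n))
    (r := fun ab => p ab.1 * q ab.2 * ((φ ab.1 ab.2).ofLp ⬝ᵥ v))
    (f := fun ab => p ab.1 * q ab.2)
    (g := fun ab => p ab.1 * q ab.2 * ((φ ab.1 ab.2).ofLp ⬝ᵥ v) ^ 2)
    (fun ab _ => mul_nonneg (hp.1 _) (hq.1 _))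
    (fun ab _ => mul_nonneg (mul_nonneg (hp.1 _) (hq.1 _)) (sq_nonneg _))
    (fun ab _ => le_of_eq (by ring))
  simp only [Fintype.sum_prod_type] at h
  rwa [sum_sum_mul_eq_one hp hq, one_mul] at h

lemma sum_sum_mul_le (hp : p ∈ stdSimplex ℝ (Fin m)) (hq : q ∈ stdSimplex ℝ (Fin n))
    {g : Fin m → Fin n → ℝ} {c : ℝ} (hg : ∀ a b, g a b ≤ c) :
    ∑ a, ∑ b, p a * q b * g a b ≤ c := by
  calc _ ≤ ∑ a, ∑ b, p a * q b * c := Finset.sum_le_sum fun a _ => Finset.sum_le_sum fun b _ =>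
        mul_le_mul_of_nonneg_left (hg a b) (mul_nonneg (hp.1 a) (hq.1 b))
    _ = c := by
        simp_rw [← Finset.sum_mul]
        rw [sum_sum_mul_eq_one hp hq, one_mul]

open Matrix in
lemma meanFeature_dotProduct_self_le (hφ : ∀ i j, ‖φ i j‖ ≤ 1) (hp : p ∈ stdSimplex ℝ (Fin m))
    (hq : q ∈ stdSimplex ℝ (Fin n)) : meanFeature φ p q ⬝ᵥ meanFeature φ p q ≤ 1 := by
  set v := meanFeature φ p q
  have h0 : 0 ≤ v ⬝ᵥ v := by simpa using dotProduct_star_self_nonneg v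
  have h : (v ⬝ᵥ v) ^ 2 ≤ v ⬝ᵥ v := by
    refine (meanFeature_dotProduct_sq_le hp hq v).trans (sum_sum_mul_le hp hq fun a b => ?_)
    have h1 : ((φ a b).ofLp ⬝ᵥ v) ^ 2 ≤ ((φ a b).ofLp ⬝ᵥ (φ a b).ofLp) * (v ⬝ᵥ v) := by
      simpa [dotProduct, sq] using
        Finset.sum_mul_sq_le_sq_mul_sq Finset.univ (φ a b).ofLp v
    have h2 : (φ a b).ofLp ⬝ᵥ (φ a b).ofLp ≤ 1 := by
      have h3 := EuclideanSpace.real_norm_sq_eq (φ a b)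
      have h4 : ‖φ a b‖ ^ 2 ≤ 1 := by
        have := norm_nonneg (φ a b)
        nlinarith [hφ a b]
      simpa [dotProduct, ← sq, ← h3] using h4
    nlinarith
  nlinarith

/-- The KL terms do not involve the payoff and cancel, which is why neither `β` nor the reference
policies enter any bound. -/
lemma value_sub_value (A A' : Matrix (Fin m) (Fin n) ℝ) :
    value R A p q - value R A' p q = ∑ a, ∑ b, p a * q b * (A a b - A' a b) := by
  have : ∑ a, ∑ b, p a * q b * (A a b - A' a b)
      = (∑ a, ∑ b, p a * A a b * q b) - ∑ a, ∑ b, p a * A' a b * q b := by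
    simp_rw [← Finset.sum_sub_distrib]
    exact Finset.sum_congr rfl fun a _ => Finset.sum_congr rfl fun b _ => by ring
  rw [this]
  unfold value
  ring

open Matrix in
lemma value_payoff_sub (ω ω' : EuclideanSpace ℝ (Fin d)) :
    value R (payoff φ ω) p q - value R (payoff φ ω') p q
      = meanFeature φ p q ⬝ᵥ (ω - ω').ofLp := by
  simp_rw [value_sub_value, meanFeature_dotProduct, payoff_sub_payoff]

lemma bestMax_eq {A : Matrix (Fin m) (Fin n) ℝ} (hp : p ∈ maxPolicies R)
    (hmax : IsMaxOn (fun p => value R A p q) (maxPolicies R) p) :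
    bestMax R A q = value R A p q :=
  IsGreatest.csSup_eq ⟨⟨p, hp, rfl⟩, by rintro _ ⟨p', hp', rfl⟩; exact hmax hp'⟩

lemma bestMin_eq {A : Matrix (Fin m) (Fin n) ℝ} (hq : q ∈ minPolicies R)
    (hmin : IsMinOn (fun q => value R A p q) (minPolicies R) q) :
    bestMin R A p = value R A p q :=
  IsLeast.csInf_eq ⟨⟨q, hq, rfl⟩, by rintro _ ⟨q', hq', rfl⟩; exact hmin hq'⟩

lemma abs_value_sub_le (hp : p ∈ stdSimplex ℝ (Fin m)) (hq : q ∈ stdSimplex ℝ (Fin n))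
    {A A' : Matrix (Fin m) (Fin n) ℝ} {B : ℝ} (hA : ∀ a b, |A a b| ≤ B)
    (hA' : ∀ a b, |A' a b| ≤ B) : |value R A p q - value R A' p q| ≤ 2 * B := by
  have h : ∀ a b, |A a b - A' a b| ≤ 2 * B := fun a b =>
    (abs_sub _ _).trans (by linarith [hA a b, hA' a b])
  rw [abs_le]
  constructor
  · have h1 := value_sub_value (R := R) (p := p) (q := q) A' A
    have h2 := sum_sum_mul_le hp hq (g := fun a b => A' a b - A a b) fun a b => by
      rw [← neg_sub]
      exact (neg_le_abs _).trans (h a b)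
    linarith
  · rw [value_sub_value]
    exact sum_sum_mul_le hp hq fun a b => (le_abs_self _).trans (h a b)

/-- An equilibrium of one bounded game has a bounded duality gap in any other. -/
lemma dualGap_le_of_isNash {A A' : Matrix (Fin m) (Fin n) ℝ} {B : ℝ} (hA : ∀ a b, |A a b| ≤ B)
    (hA' : ∀ a b, |A' a b| ≤ B) (h : IsNash R A' p q) : dualGap R A p q ≤ 4 * B := by
  obtain ⟨hp, hq, hmax, hmin⟩ := h
  have h1 : bestMax R A q ≤ value R A' p q + 2 * B := by
    refine csSup_le ⟨_, p, hp, rfl⟩ ?_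
    rintro _ ⟨p', hp', rfl⟩
    have h2 := (abs_le.1 (abs_value_sub_le (R := R) hp'.1 hq.1 hA hA')).2
    have h3 : value R A' p' q ≤ value R A' p q := hmax hp'
    simp only
    linarith
  have h2 : value R A' p q - 2 * B ≤ bestMin R A p := by
    refine le_csInf ⟨_, q, hq, rfl⟩ ?_
    rintro _ ⟨q', hq', rfl⟩
    have h2 := (abs_le.1 (abs_value_sub_le (R := R) hp.1 hq'.1 hA hA')).1
    have h3 : value R A' p q ≤ value R A' p q' := hmin hq'
    simp only
    linarith
  unfold dualGap
  linarith

open Matrix in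
/-- The duality gap, in a new model, of an equilibrium of the old one is the difference of the
model changes seen by the two best responses. -/
lemma dualGap_payoff_le {ω ω' : EuclideanSpace ℝ (Fin d)} (h : IsNash R (payoff φ ω) p q)
    {p' : Fin m → ℝ} {q' : Fin n → ℝ} (hp' : p' ∈ maxPolicies R) (hq' : q' ∈ minPolicies R)
    (hmax : IsMaxOn (fun p => value R (payoff φ ω') p q) (maxPolicies R) p')
    (hmin : IsMinOn (fun q => value R (payoff φ ω') p q) (minPolicies R) q') :
    dualGap R (payoff φ ω') p q ≤
      meanFeature φ p' q ⬝ᵥ (ω' - ω).ofLp - meanFeature φ p q' ⬝ᵥ (ω' - ω).ofLp := by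
  obtain ⟨-, -, h1, h2⟩ := h
  have h1 : value R (payoff φ ω) p' q ≤ value R (payoff φ ω) p q := h1 hp'
  have h2 : value R (payoff φ ω) p q ≤ value R (payoff φ ω) p q' := h2 hq'
  unfold dualGap
  rw [bestMax_eq hp' hmax, bestMin_eq hq' hmin, ← value_payoff_sub (R := R),
    ← value_payoff_sub (R := R)]
  linarith

end Game

/-! ### The deterministic regret bound on the good event. -/

namespace Feedback

variable {S : Type*} [mS : MeasurableSpace S] {m n : ℕ} {P : Measure S}
  {A : Matrix (Fin m) (Fin n) ℝ} {σ : ℝ} {T : ℕ} (r : Feedback P A σ T)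

/-- The expected squared deviation of `A'` from `A` over the first `k` rounds. -/
def sqDev (A' : Matrix (Fin m) (Fin n) ℝ) (k : ℕ) (x : S) : ℝ :=
  ∑ s ∈ Finset.range k, ∑ a, ∑ b, r.p s x a * r.q s x b * (A' a b - A a b) ^ 2

/-- An upper bound on the excess is thus a bound on the loss difference with a quarter of `sqDev` to
spare. -/
lemma totalExcess_eq (A' : Matrix (Fin m) (Fin n) ℝ) (k : ℕ) (x : S) :
    r.totalExcess (A' - A) k x = ∑ s ∈ Finset.range k,
        ((A (r.i s x) (r.j s x) - r.y s x) ^ 2 - (A' (r.i s x) (r.j s x) - r.y s x) ^ 2)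
      + 1 / 4 * r.sqDev A' k x := by
  rw [totalExcess, sqDev, Finset.mul_sum, ← Finset.sum_add_distrib]
  refine Finset.sum_congr rfl fun s _ => ?_
  simp only [excess, Matrix.sub_apply]
  ring

end Feedback

namespace Run

variable {S : Type*} [mS : MeasurableSpace S] {m n d : ℕ} {P : Measure S} {R : Reg m n}
  {A : Matrix (Fin m) (Fin n) ℝ} {φ : Fin m → Fin n → EuclideanSpace ℝ (Fin d)}
  {Θ : Set (EuclideanSpace ℝ (Fin d))} {ω₀ : EuclideanSpace ℝ (Fin d)} {α σ : ℝ} {T : ℕ}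
  (r : Run P R A φ Θ ω₀ α σ T)

/-- The queries of the entries `(i, j)`. -/
def feedbackMax : Feedback P A σ T where
  ℱ := r.ℱ
  i := r.i
  j := r.j
  y := r.y
  p := r.μt
  q := r.ν
  measurable_i := r.measurable_i
  measurable_j := r.measurable_j
  measurable_y := r.measurable_y
  measurable_p := r.measurable_μt
  measurable_q := r.measurable_ν
  p_mem k hk x := (r.μt_mem k hk x).1
  q_mem k hk x := (r.nash k hk x).2.1.1
  draw := r.draw
  noise := r.noise

/-- The queries of the entries `(i', j')`. -/
def feedbackMin : Feedback P A σ T where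
  ℱ := r.ℱ
  i := r.i'
  j := r.j'
  y := r.y'
  p := r.μ
  q := r.νt
  measurable_i := r.measurable_i'
  measurable_j := r.measurable_j'
  measurable_y := r.measurable_y'
  measurable_p := r.measurable_μ
  measurable_q := r.measurable_νt
  p_mem k hk x := (r.nash k hk x).1.1
  q_mem k hk x := (r.νt_mem k hk x).1
  draw := r.draw'
  noise := r.noise'

end Run

namespace Feedback

variable {S : Type*} [mS : MeasurableSpace S] {m n d : ℕ} {P : Measure S}
  {φ : Fin m → Fin n → EuclideanSpace ℝ (Fin d)} {ω₁ : EuclideanSpace ℝ (Fin d)}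
  {σ : ℝ} {T : ℕ} (r : Feedback P (payoff φ ω₁) σ T)

/-- The expected feature vector of the entry queried in round `k`. -/
def feature (x : S) (k : ℕ) : Fin d → ℝ := meanFeature φ (r.p k x) (r.q k x)

open Matrix in
lemma sum_feature_sq_le (ω : EuclideanSpace ℝ (Fin d)) {k : ℕ} (hk : k ≤ T) (x : S) :
    ∑ s ∈ Finset.range k, (r.feature x s ⬝ᵥ (ω - ω₁).ofLp) ^ 2 ≤ r.sqDev (payoff φ ω) k x := by
  refine Finset.sum_le_sum fun s hs => ?_
  have hsT : s < T := (Finset.mem_range.1 hs).trans_le hk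
  simp_rw [payoff_sub_payoff]
  exact meanFeature_dotProduct_sq_le (r.p_mem s hsT x) (r.q_mem s hsT x) _

open Matrix in
lemma feature_dotProduct_sq_le {B : ℝ} {ω : EuclideanSpace ℝ (Fin d)}
    (hω : ∀ i j, |payoff φ ω i j| ≤ B) (hω₁ : ∀ i j, |payoff φ ω₁ i j| ≤ B) {k : ℕ} (hk : k < T)
    (x : S) : (r.feature x k ⬝ᵥ (ω - ω₁).ofLp) ^ 2 ≤ 4 * B ^ 2 := by
  refine (meanFeature_dotProduct_sq_le (r.p_mem k hk x) (r.q_mem k hk x) _).trans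
    (sum_sum_mul_le (r.p_mem k hk x) (r.q_mem k hk x) fun a b => ?_)
  rw [← payoff_sub_payoff, ← sq_abs]
  have h : |payoff φ ω a b - payoff φ ω₁ a b| ≤ 2 * B :=
    (abs_sub _ _).trans (by linarith [hω a b, hω₁ a b])
  nlinarith [abs_nonneg (payoff φ ω a b - payoff φ ω₁ a b)]

end Feedback

namespace Run

variable {S : Type*} [mS : MeasurableSpace S] {m n d : ℕ} {P : Measure S} {R : Reg m n}
  {φ : Fin m → Fin n → EuclideanSpace ℝ (Fin d)}
  {Θ : Set (EuclideanSpace ℝ (Fin d))} {ω₀ ω₁ : EuclideanSpace ℝ (Fin d)} {α σ : ℝ} {T : ℕ}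
  (r : Run P R (payoff φ ω₁) φ Θ ω₀ α σ T)

lemma objective_sub (k : ℕ) (x : S) (μ : Fin m → ℝ) (ν : Fin n → ℝ)
    (ω : EuclideanSpace ℝ (Fin d)) :
    objective R φ α k (fun s => r.i s x) (fun s => r.j s x) (fun s => r.y s x)
        (fun s => r.i' s x) (fun s => r.j' s x) (fun s => r.y' s x) μ ν ω₁
      - objective R φ α k (fun s => r.i s x) (fun s => r.j s x) (fun s => r.y s x)
        (fun s => r.i' s x) (fun s => r.j' s x) (fun s => r.y' s x) μ ν ω
      = (r.feedbackMax.totalExcess (payoff φ ω - payoff φ ω₁) k x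
          + r.feedbackMin.totalExcess (payoff φ ω - payoff φ ω₁) k x)
        - 1 / 4 * (r.feedbackMax.sqDev (payoff φ ω) k x + r.feedbackMin.sqDev (payoff φ ω) k x)
        + α * (dualGap R (payoff φ ω) μ ν - dualGap R (payoff φ ω₁) μ ν) := by
  rw [Feedback.totalExcess_eq, Feedback.totalExcess_eq]
  simp only [objective, dualGap, feedbackMax, feedbackMin, Finset.sum_add_distrib,
    Finset.sum_sub_distrib]
  ring

-- The optimism step: `objective_sub` is nonnegative at the minimiser, which trades the true gap for
-- the gap of the updated model; the latter is linear in `ω (k+1) - ω k` and is split around `ω₁`.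
open Matrix in
lemma dualGap_le (hα : 0 < α) (hω₁ : ω₁ ∈ Θ) {k : ℕ} (hk : k < T) (x : S) :
    dualGap R (payoff φ ω₁) (r.μ k x) (r.ν k x) ≤
      (|r.feedbackMax.feature x k ⬝ᵥ (r.ω (k + 1) x - ω₁).ofLp|
        + |r.feedbackMax.feature x k ⬝ᵥ (r.ω k x - ω₁).ofLp|)
      + (|r.feedbackMin.feature x k ⬝ᵥ (r.ω (k + 1) x - ω₁).ofLp|
        + |r.feedbackMin.feature x k ⬝ᵥ (r.ω k x - ω₁).ofLp|)
      + ((r.feedbackMax.totalExcess (payoff φ (r.ω (k + 1) x) - payoff φ ω₁) k x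
          + r.feedbackMin.totalExcess (payoff φ (r.ω (k + 1) x) - payoff φ ω₁) k x)
        - 1 / 4 * (r.feedbackMax.sqDev (payoff φ (r.ω (k + 1) x)) k x
          + r.feedbackMin.sqDev (payoff φ (r.ω (k + 1) x)) k x)) / α := by
  have h1 := dualGap_payoff_le (r.nash k hk x) (r.μt_mem k hk x) (r.νt_mem k hk x)
    (r.μt_max k hk x) (r.νt_min k hk x)
  have h2 := r.model_min k hk x hω₁
  have h3 := r.objective_sub k x (r.μ k x) (r.ν k x) (r.ω (k + 1) x)
  set L := (r.feedbackMax.totalExcess (payoff φ (r.ω (k + 1) x) - payoff φ ω₁) k x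
          + r.feedbackMin.totalExcess (payoff φ (r.ω (k + 1) x) - payoff φ ω₁) k x)
        - 1 / 4 * (r.feedbackMax.sqDev (payoff φ (r.ω (k + 1) x)) k x
          + r.feedbackMin.sqDev (payoff φ (r.ω (k + 1) x)) k x)
  have h4 : dualGap R (payoff φ ω₁) (r.μ k x) (r.ν k x)
      ≤ dualGap R (payoff φ (r.ω (k + 1) x)) (r.μ k x) (r.ν k x) + L / α := by
    rw [← sub_le_iff_le_add', le_div_iff₀ hα]
    simp only [Set.mem_ofPred_eq] at h2
    linarith
  have h5 : (r.ω (k + 1) x - r.ω k x).ofLp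
      = (r.ω (k + 1) x - ω₁).ofLp - (r.ω k x - ω₁).ofLp := by
    ext c
    simp
  change _ ≤ r.feedbackMax.feature x k ⬝ᵥ _ - r.feedbackMin.feature x k ⬝ᵥ _ at h1
  rw [h5, dotProduct_sub, dotProduct_sub] at h1
  have e1 := le_abs_self (r.feedbackMax.feature x k ⬝ᵥ (r.ω (k + 1) x - ω₁).ofLp)
  have e2 := neg_abs_le (r.feedbackMax.feature x k ⬝ᵥ (r.ω k x - ω₁).ofLp)
  have e3 := neg_abs_le (r.feedbackMin.feature x k ⬝ᵥ (r.ω (k + 1) x - ω₁).ofLp)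
  have e4 := le_abs_self (r.feedbackMin.feature x k ⬝ᵥ (r.ω k x - ω₁).ofLp)
  linarith

lemma ω_mem (hω₀ : ω₀ ∈ Θ) {k : ℕ} (hk : k ≤ T) (x : S) : r.ω k x ∈ Θ := by
  cases k with
  | zero => rw [r.init x]; exact hω₀
  | succ k => exact r.model_mem k hk x

open Matrix in
/-- The regret on the event where the squared losses concentrate. -/
lemma regret_le (hα : 0 < α) (hφ : ∀ i j, ‖φ i j‖ ≤ 1) (hΘ : Θ ⊆ Metric.closedBall 0 √d) {B : ℝ}
    (hB : ∀ ω ∈ Θ, ∀ i j, |payoff φ ω i j| ≤ B) (hω₀ : ω₀ ∈ Θ) (hω₁ : ω₁ ∈ Θ) {W : ℝ} {x : S}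
    (hmax : ∀ k < T, ∀ ω ∈ Θ, r.feedbackMax.totalExcess (payoff φ ω - payoff φ ω₁) k x ≤ W)
    (hmin : ∀ k < T, ∀ ω ∈ Θ, r.feedbackMin.totalExcess (payoff φ ω - payoff φ ω₁) k x ≤ W) :
    r.regret x ≤ 16 * (α * (d * Real.log (1 + T))) + T * (2 * d + B ^ 2 + 2 * W) / α := by
  set u : ℕ → Fin d → ℝ := fun k => (r.ω k x - ω₁).ofLp with hu
  -- The choice `K = 4α` gives the in-sample errors weight `1/(4α)`, which is exactly cancelled by
  -- the term `-(1/4) sqDev / α`.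
  have hK : 0 < 4 * α := by positivity
  have hu4 : ∀ k ≤ T, u k ⬝ᵥ u k ≤ 4 * d := by
    intro k hk
    have h1 := EuclideanSpace.real_norm_sq_eq (r.ω k x - ω₁)
    have h2 : ‖r.ω k x - ω₁‖ ≤ 2 * √d := by
      have h3 := mem_closedBall_zero_iff.1 (hΘ (r.ω_mem hω₀ hk x))
      have h4 := mem_closedBall_zero_iff.1 (hΘ hω₁)
      exact (norm_sub_le _ _).trans (by linarith)
    have h5 : u k ⬝ᵥ u k = ‖r.ω k x - ω₁‖ ^ 2 := by
      rw [h1]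
      simp [hu, dotProduct, sq]
    rw [h5]
    calc _ ≤ (2 * √(d : ℝ)) ^ 2 := by gcongr
      _ = 4 * d := by
        rw [mul_pow, Real.sq_sqrt (Nat.cast_nonneg d)]
        norm_num
  have key : ∀ F : Feedback P (payoff φ ω₁) σ T,
      ∑ k ∈ Finset.range T, (|F.feature x k ⬝ᵥ u (k + 1)| + |F.feature x k ⬝ᵥ u k|) ≤
        2 * (4 * α) * (d * Real.log (1 + T)) + (T * (4 * d) + T * (4 * B ^ 2) / 2 +
          ∑ k ∈ Finset.range T, F.sqDev (payoff φ (r.ω (k + 1) x)) k x) / (4 * α) := by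
    intro F
    refine (sum_abs_dotProduct_add_le (x := F.feature x) (u := u)
      (fun s hs => meanFeature_dotProduct_self_le hφ (F.p_mem s hs x) (F.q_mem s hs x)) hu4
      (by positivity) (fun k hk => F.feature_dotProduct_sq_le
        (hB _ (r.model_mem k hk x)) (hB _ hω₁) hk x) hK).trans ?_
    gcongr with k hk
    exact F.sum_feature_sq_le _ (Finset.mem_range.1 hk).le x
  have h1 := key r.feedbackMax
  have h2 := key r.feedbackMin
  set Q₁ := ∑ k ∈ Finset.range T, r.feedbackMax.sqDev (payoff φ (r.ω (k + 1) x)) k x with hQ₁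
  set Q₂ := ∑ k ∈ Finset.range T, r.feedbackMin.sqDev (payoff φ (r.ω (k + 1) x)) k x with hQ₂
  have h3 : r.regret x ≤ ∑ k ∈ Finset.range T,
      ((|r.feedbackMax.feature x k ⬝ᵥ u (k + 1)| + |r.feedbackMax.feature x k ⬝ᵥ u k|)
      + (|r.feedbackMin.feature x k ⬝ᵥ u (k + 1)| + |r.feedbackMin.feature x k ⬝ᵥ u k|)
      + (2 * W - 1 / 4 * (r.feedbackMax.sqDev (payoff φ (r.ω (k + 1) x)) k x
          + r.feedbackMin.sqDev (payoff φ (r.ω (k + 1) x)) k x)) / α) := by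
    refine Finset.sum_le_sum fun k hk => ?_
    have hkT := Finset.mem_range.1 hk
    refine (r.dualGap_le hα hω₁ hkT x).trans ?_
    have h4 := hmax k hkT _ (r.model_mem k hkT x)
    have h5 := hmin k hkT _ (r.model_mem k hkT x)
    gcongr
    linarith
  have hs : ∀ f g a b : ℕ → ℝ,
      ∑ k ∈ Finset.range T, (f k + g k + (2 * W - 1 / 4 * (a k + b k)) / α)
        = ∑ k ∈ Finset.range T, f k + ∑ k ∈ Finset.range T, g k
          + (T * (2 * W) - 1 / 4 * (∑ k ∈ Finset.range T, a k + ∑ k ∈ Finset.range T, b k)) / α := by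
    intro f g a b
    simp only [Finset.sum_add_distrib, ← Finset.sum_div, Finset.sum_sub_distrib, ← Finset.mul_sum,
      Finset.sum_const, Finset.card_range, nsmul_eq_mul]
    ring
  rw [hs] at h3
  calc r.regret x ≤ (2 * (4 * α) * (d * Real.log (1 + T))
        + (T * (4 * d) + T * (4 * B ^ 2) / 2 + Q₁) / (4 * α))
      + (2 * (4 * α) * (d * Real.log (1 + T))
        + (T * (4 * d) + T * (4 * B ^ 2) / 2 + Q₂) / (4 * α))
      + (T * (2 * W) - 1 / 4 * (Q₁ + Q₂)) / α := by linarith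
    _ = _ := by
      field_simp
      ring

end Run

/-! ### The rate and the choice of `α`. -/

/-- The rate `d√T (1 + √((log(4T/δ)/d + log(1 + 2√d T)) log(1 + (T/d)^{3/2})))`. -/
noncomputable def rate (d T : ℕ) (δ : ℝ) : ℝ :=
  d * √T * (1 + √((Real.log (4 * T / δ) / d + Real.log (1 + 2 * √d * T)) *
    Real.log (1 + ((T : ℝ) / d) ^ (3 / 2 : ℝ))))

/-- For `T ≥ d²` one has `1 ≤ √T ≤ T/d ≤ (T/d)^{3/2}`, and `1 + T ≤ (1 + √T)²`. This replaces the
logarithm of the potential lemma by the one in `alpha`. -/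
lemma log_one_add_le_of_sq_le {d T : ℕ} (hd : 1 ≤ d) (hdT : d ^ 2 ≤ T) :
    Real.log (1 + T) ≤ 2 * Real.log (1 + ((T : ℝ) / d) ^ (3 / 2 : ℝ)) := by
  have hd0 : (1 : ℝ) ≤ d := by exact_mod_cast hd
  have hdT0 : (d : ℝ) ^ 2 ≤ T := by exact_mod_cast hdT
  have hT0 : (1 : ℝ) ≤ T := by nlinarith
  have hds : (d : ℝ) ≤ √T := Real.le_sqrt_of_sq_le hdT0
  have hsq : √(T : ℝ) * √T = T := Real.mul_self_sqrt (by positivity)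
  have hs1 : 1 ≤ √(T : ℝ) := hd0.trans hds
  have h1 : √(T : ℝ) ≤ T / d := by
    rw [le_div_iff₀ (by positivity)]
    nlinarith
  have h2 : (T : ℝ) / d ≤ ((T : ℝ) / d) ^ (3 / 2 : ℝ) :=
    Real.self_le_rpow_of_one_le (hs1.trans h1) (by norm_num)
  calc Real.log (1 + T) ≤ Real.log ((1 + ((T : ℝ) / d) ^ (3 / 2 : ℝ)) ^ 2) := by
        refine Real.log_le_log (by positivity) ?_
        nlinarith
    _ = _ := by
        rw [Real.log_pow]
        norm_num

lemma log_one_add_rpow_le {d T : ℕ} (hd : 1 ≤ d) (hT : 1 ≤ T) :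
    Real.log (1 + ((T : ℝ) / d) ^ (3 / 2 : ℝ)) ≤ 2 * Real.log (1 + T) := by
  have hd0 : (1 : ℝ) ≤ d := by exact_mod_cast hd
  have hT0 : (1 : ℝ) ≤ T := by exact_mod_cast hT
  have h1 : ((T : ℝ) / d) ^ (3 / 2 : ℝ) ≤ (T : ℝ) ^ 2 := by
    calc ((T : ℝ) / d) ^ (3 / 2 : ℝ) ≤ (T : ℝ) ^ (3 / 2 : ℝ) := by
          refine Real.rpow_le_rpow (by positivity) (div_le_self (by positivity) hd0) (by norm_num)
      _ ≤ (T : ℝ) ^ (2 : ℝ) := Real.rpow_le_rpow_of_exponent_le hT0 (by norm_num)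
      _ = (T : ℝ) ^ 2 := Real.rpow_two _
  calc _ ≤ Real.log ((1 + T) ^ 2) := by
        refine Real.log_le_log (by positivity) ?_
        nlinarith
    _ = _ := by
        rw [Real.log_pow]
        norm_num

lemma log_one_add_rpow_pos {d T : ℕ} (hd : 1 ≤ d) (hT : 1 ≤ T) :
    0 < Real.log (1 + ((T : ℝ) / d) ^ (3 / 2 : ℝ)) := by
  have : (0 : ℝ) < T / d := by
    have : 0 < (d : ℝ) := by exact_mod_cast hd
    have : 0 < (T : ℝ) := by exact_mod_cast hT
    positivity
  refine Real.log_pos ?_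
  have := Real.rpow_pos_of_pos this (3 / 2)
  linarith

lemma alpha_eq {d T : ℕ} {δ : ℝ} : alpha d T δ =
    √(T * complexity d T δ / (d * Real.log (1 + ((T : ℝ) / d) ^ (3 / 2 : ℝ)))) := rfl

lemma alpha_pos {d T : ℕ} (hd : 1 ≤ d) (hT : 1 ≤ T) {δ : ℝ} (hδ : 0 < δ) (hδ1 : δ < 1) :
    0 < alpha d T δ := by
  have h1 := one_le_complexity hd hT hδ hδ1
  have h2 := log_one_add_rpow_pos hd hT
  have : 0 < (d : ℝ) := by exact_mod_cast hd
  have : 0 < (T : ℝ) := by exact_mod_cast hT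
  rw [alpha_eq]
  positivity

/-- The two terms of the regret bound are balanced by this `α`; their common value is compared with
the rate in `alpha_mul_le_rate`. -/
lemma alpha_mul_eq {d T : ℕ} (hd : 1 ≤ d) (hT : 1 ≤ T) {δ : ℝ} (hδ : 0 < δ) (hδ1 : δ < 1) :
    alpha d T δ * (d * Real.log (1 + ((T : ℝ) / d) ^ (3 / 2 : ℝ)))
      = T * complexity d T δ / alpha d T δ := by
  have h1 := one_le_complexity hd hT hδ hδ1
  have h2 := log_one_add_rpow_pos hd hT
  have h3 : 0 < (d : ℝ) := by exact_mod_cast hd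
  have h4 : 0 < (T : ℝ) := by exact_mod_cast hT
  rw [eq_div_iff (alpha_pos hd hT hδ hδ1).ne', mul_right_comm, alpha_eq,
    Real.mul_self_sqrt (by positivity)]
  field_simp

lemma alpha_mul_le_rate {d T : ℕ} (hd : 1 ≤ d) (hT : 1 ≤ T) {δ : ℝ} (hδ : 0 < δ) (hδ1 : δ < 1) :
    alpha d T δ * (d * Real.log (1 + ((T : ℝ) / d) ^ (3 / 2 : ℝ))) ≤ rate d T δ := by
  have h1 := one_le_complexity hd hT hδ hδ1
  have h2 := log_one_add_rpow_pos hd hT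
  have h3 : 0 < (d : ℝ) := by exact_mod_cast hd
  have h4 : 0 < (T : ℝ) := by exact_mod_cast hT
  have h5 : Real.log (4 * T / δ) / d + Real.log (1 + 2 * √d * T) = complexity d T δ / d := by
    unfold complexity
    field_simp
  rw [rate, h5, alpha_eq]
  set ℓ := Real.log (1 + ((T : ℝ) / d) ^ (3 / 2 : ℝ))
  set N := complexity d T δ
  have h6 : √(T * N / (d * ℓ)) * (d * ℓ) = d * √T * √(N / d * ℓ) := by
    rw [← Real.sqrt_sq (show 0 ≤ √(T * N / (d * ℓ)) * (d * ℓ) by positivity),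
      ← Real.sqrt_sq (show 0 ≤ d * √(T : ℝ) * √(N / d * ℓ) by positivity)]
    congr 1
    rw [mul_pow, mul_pow, mul_pow, mul_pow, Real.sq_sqrt (by positivity), Real.sq_sqrt (by positivity),
      Real.sq_sqrt (by positivity)]
    field_simp
  rw [h6]
  have : 0 ≤ d * √(T : ℝ) := by positivity
  linarith

/-- The bound on entries is not vacuous: a simplex over an empty index type has no point, whereas
reference policies exist. -/
lemma Reg.bound_nonneg {m n : ℕ} (R : Reg m n) {A : Matrix (Fin m) (Fin n) ℝ} {B : ℝ}
    (hA : ∀ i j, |A i j| ≤ B) : 0 ≤ B := by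
  rcases m with _ | m
  · simpa using R.μref_mem.2
  rcases n with _ | n
  · simpa using R.νref_mem.2
  exact (abs_nonneg _).trans (hA 0 0)

lemma abs_payoff_le {m n d : ℕ} {φ : Fin m → Fin n → EuclideanSpace ℝ (Fin d)}
    (hφ : ∀ i j, ‖φ i j‖ ≤ 1) {ω : EuclideanSpace ℝ (Fin d)} (hω : ‖ω‖ ≤ √d) (a : Fin m)
    (b : Fin n) : |payoff φ ω a b| ≤ √d := by
  have h := abs_payoff_sub_le hφ ω 0 a b
  simp only [payoff, Matrix.of_apply, inner_zero_right, sub_zero] at h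
  exact h.trans hω

lemma one_sub_le_real_of_compl_subset {S : Type*} [MeasurableSpace S] {P : Measure S}
    [IsProbabilityMeasure P] {δ : ℝ} (hδ : 0 ≤ δ) {E G : Set S} (hE : P E ≤ ENNReal.ofReal δ)
    (hG : ∀ x ∉ E, x ∈ G) : 1 - δ ≤ P.real G := by
  have h1 : P.real (E ∪ G) = 1 := by
    rw [show E ∪ G = Set.univ from Set.eq_univ_of_forall fun x => by
      by_cases hx : x ∈ E
      · exact Or.inl hx
      · exact Or.inr (hG x hx)]
    simp
  have h2 : P.real E ≤ δ := ENNReal.toReal_le_of_le_ofReal hδ hE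
  have h3 := measureReal_union_le (μ := P) E G
  linarith

/-! ### The regret bound with high probability. -/

namespace Run

variable {S : Type*} [mS : MeasurableSpace S] {m n d : ℕ} {P : Measure S} {R : Reg m n}
  {A : Matrix (Fin m) (Fin n) ℝ} {φ : Fin m → Fin n → EuclideanSpace ℝ (Fin d)}
  {Θ : Set (EuclideanSpace ℝ (Fin d))} {ω₀ : EuclideanSpace ℝ (Fin d)} {α σ : ℝ} {T : ℕ}

lemma dualGap_le_of_bound (r : Run P R A φ Θ ω₀ α σ T) {B : ℝ}
    (hB : ∀ ω ∈ Θ, ∀ i j, |payoff φ ω i j| ≤ B) (hreal : ∃ ω ∈ Θ, payoff φ ω = A)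
    (hω₀ : ω₀ ∈ Θ) {k : ℕ} (hk : k < T) (x : S) :
    dualGap R A (r.μ k x) (r.ν k x) ≤ 4 * B := by
  obtain ⟨ω₁, hω₁, rfl⟩ := hreal
  exact dualGap_le_of_isNash (hB ω₁ hω₁) (hB _ (r.ω_mem hω₀ hk.le x)) (r.nash k hk x)

/-- The regret bound holds off an event of probability at most `δ`. -/
theorem exists_event_regret_le [IsProbabilityMeasure P] (hd : 1 ≤ d) (hT : 1 ≤ T)
    (hφ : ∀ i j, ‖φ i j‖ ≤ 1) (hΘ : Θ ⊆ Metric.closedBall 0 √d) {B δ : ℝ}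
    (hB : ∀ ω ∈ Θ, ∀ i j, |payoff φ ω i j| ≤ B) (hreal : ∃ ω ∈ Θ, payoff φ ω = A)
    (hω₀ : ω₀ ∈ Θ) (hσ : 0 ≤ σ) (hδ : 0 < δ) (hδ1 : δ < 1)
    (r : Run P R A φ Θ ω₀ (alpha d T δ) σ T) :
    ∃ E : Set S, P E ≤ ENNReal.ofReal δ ∧
      ∀ x ∉ E, r.regret x ≤ 81 * (1 + B + σ) ^ 2 * rate d T δ := by
  have hB0 : 0 ≤ B := R.bound_nonneg (hB ω₀ hω₀)
  have hd0 : (1 : ℝ) ≤ d := by exact_mod_cast hd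
  have hT0 : (1 : ℝ) ≤ T := by exact_mod_cast hT
  set D := 1 + B + σ with hD
  have hD1 : 1 ≤ D := by linarith
  have hBD : B ≤ D := by linarith
  -- For `T ≤ d²` each gap is at most `4B` and `T ≤ d√T`, so no exceptional event is needed;
  -- otherwise `log_one_add_le_of_sq_le` applies.
  rcases le_or_gt T (d ^ 2) with hTd | hTd
  · refine ⟨∅, by simp, fun x _ => ?_⟩
    have h1 : r.regret x ≤ T * (4 * B) := by
      refine (Finset.sum_le_sum fun k hk =>
        r.dualGap_le_of_bound hB hreal hω₀ (Finset.mem_range.1 hk) x).trans ?_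
      simp
    have h2 : (T : ℝ) ≤ d * √T := by
      have h3 : √(T : ℝ) ≤ d := Real.sqrt_le_iff.2 ⟨by positivity, by exact_mod_cast hTd⟩
      have h4 : √(T : ℝ) * √T = T := Real.mul_self_sqrt (by positivity)
      nlinarith [Real.sqrt_nonneg (T : ℝ)]
    have h3 : d * √(T : ℝ) ≤ rate d T δ := by
      unfold rate
      exact le_mul_of_one_le_right (by positivity) (le_add_of_nonneg_right (Real.sqrt_nonneg _))
    calc r.regret x ≤ T * (4 * B) := h1
      _ ≤ rate d T δ * (81 * D ^ 2) := mul_le_mul (h2.trans h3) (by nlinarith) (by positivity)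
        ((Nat.cast_nonneg T).trans (h2.trans h3))
      _ = _ := by ring
  · obtain ⟨ω₁, hω₁, rfl⟩ := hreal
    obtain ⟨E₁, hE₁, h₁⟩ := r.feedbackMax.exists_event hd hT hφ hΘ hB0 hB ⟨ω₁, hω₁, rfl⟩ hσ hδ hδ1
    obtain ⟨E₂, hE₂, h₂⟩ := r.feedbackMin.exists_event hd hT hφ hΘ hB0 hB ⟨ω₁, hω₁, rfl⟩ hσ hδ hδ1
    refine ⟨E₁ ∪ E₂, ?_, fun x hx => ?_⟩
    · refine (measure_union_le _ _).trans ((add_le_add hE₁ hE₂).trans ?_)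
      rw [← ENNReal.ofReal_add (by positivity) (by positivity), add_halves]
    rw [Set.mem_union, not_or] at hx
    have hα := alpha_pos hd hT hδ hδ1
    have h3 := r.regret_le hα hφ hΘ hB hω₀ hω₁ (h₁ x hx.1) (h₂ x hx.2)
    have h4 := log_one_add_le_of_sq_le hd hTd.le
    have h5 := alpha_mul_eq hd hT hδ hδ1
    have h6 := alpha_mul_le_rate hd hT hδ hδ1
    have hN1 := one_le_complexity hd hT hδ hδ1
    have hNd : (d : ℝ) ≤ complexity d T δ := by
      have h7 := one_le_log_one_add_two_mul hd hT
      have h8 := one_le_log_four_mul_div hT hδ hδ1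
      unfold complexity
      nlinarith
    rw [← hD] at h3
    generalize r.regret x = ρ at h3 ⊢
    set N := complexity d T δ
    set ℓ := Real.log (1 + ((T : ℝ) / d) ^ (3 / 2 : ℝ))
    set α := alpha d T δ
    have h7 : α * (d * Real.log (1 + T)) ≤ 2 * (α * (d * ℓ)) := by
      have : α * (d * Real.log (1 + T)) ≤ α * (d * (2 * ℓ)) := by gcongr
      linarith
    have h8 : T * (2 * d + B ^ 2 + 2 * (23 * D ^ 2 * N)) / α ≤ 49 * D ^ 2 * (α * (d * ℓ)) := by
      rw [h5, mul_div_assoc', div_le_div_iff_of_pos_right hα]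
      -- Here `49 = 2 + 1 + 46`; adding the `32` from the potential term gives the final `81`.
      have h9 : 2 * d + B ^ 2 + 2 * (23 * D ^ 2 * N) ≤ 49 * D ^ 2 * N := by
        have h10 : B ^ 2 ≤ D ^ 2 := by gcongr
        have h11 : D ^ 2 ≤ D ^ 2 * N := le_mul_of_one_le_right (by positivity) hN1
        have h12 : N ≤ D ^ 2 * N := le_mul_of_one_le_left (by positivity) (by nlinarith)
        linarith
      calc _ ≤ T * (49 * D ^ 2 * N) := by gcongr
        _ = _ := by ring
    have h9 : 0 ≤ α * (d * ℓ) := by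
      have := log_one_add_rpow_pos hd hT
      positivity
    calc ρ ≤ 32 * (α * (d * ℓ)) + 49 * D ^ 2 * (α * (d * ℓ)) := by linarith
      _ ≤ 81 * D ^ 2 * (α * (d * ℓ)) := by
        have := le_mul_of_one_le_left h9 (one_le_pow₀ (n := 2) hD1)
        linarith
      _ ≤ _ := by gcongr

end Run

/-! ### Inverting the rate for the sample complexity. -/

/-- The rate in terms of `log (2 + T)` and `log (2 + X)`, when `X` dominates `√d / δ`. -/
lemma rate_le_log {d T : ℕ} (hd : 1 ≤ d) (hT : 1 ≤ T) {X δ : ℝ} (hδ : 0 < δ) (hδ1 : δ < 1)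
    (hX : √(d : ℝ) / δ ≤ 4 * X) :
    rate d T δ ≤ d * √T * (6 * (Real.log (2 + T) + Real.log (2 + X))) := by
  have hd0 : (1 : ℝ) ≤ d := by exact_mod_cast hd
  have hT0 : (1 : ℝ) ≤ T := by exact_mod_cast hT
  have hs1 : 1 ≤ √(d : ℝ) := Real.one_le_sqrt.2 hd0
  have hX1 : 1 / δ ≤ 4 * X := by
    refine le_trans ?_ hX
    gcongr
  have hX0 : 0 < X := by
    have : 0 < 1 / δ := by positivity
    linarith
  have hXd : √(d : ℝ) ≤ 4 * X := by
    refine le_trans ?_ hX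
    rw [le_div_iff₀ hδ]
    nlinarith
  have h1 : Real.log (4 * T / δ) / d ≤ 5 * Real.log (2 + T) + Real.log (2 + X) := by
    have h2 : 4 * T / δ ≤ (2 + T : ℝ) ^ 5 * (2 + X) := by
      calc 4 * T / δ = 4 * T * (1 / δ) := by ring
        _ ≤ 4 * T * (4 * X) := by gcongr
        _ = 2 ^ 4 * T * X := by ring
        _ ≤ (2 + T : ℝ) ^ 4 * (2 + T) * (2 + X) := by
          gcongr <;> linarith
        _ = _ := by ring
    have h3 := Real.log_le_log (by positivity) h2
    rw [Real.log_mul (by positivity) (by positivity), Real.log_pow] at h3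
    push_cast at h3
    have h4 := one_le_log_four_mul_div hT hδ hδ1
    exact (div_le_self (by linarith) hd0).trans h3
  have h2 : Real.log (1 + 2 * √d * T) ≤ 4 * Real.log (2 + T) + Real.log (2 + X) := by
    have h3 : 1 + 2 * √d * T ≤ (2 + T : ℝ) ^ 4 * (2 + X) := by
      calc 1 + 2 * √d * T ≤ 1 + 2 * (4 * X) * T := by gcongr
        _ ≤ 2 ^ 3 * ((2 + T) * (2 + X)) := by nlinarith
        _ ≤ (2 + T : ℝ) ^ 3 * ((2 + T) * (2 + X)) := by
          gcongr
          linarith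
        _ = _ := by ring
    have h4 := Real.log_le_log (by positivity) h3
    rw [Real.log_mul (by positivity) (by positivity), Real.log_pow] at h4
    push_cast at h4
    exact h4
  have h3 : Real.log (1 + ((T : ℝ) / d) ^ (3 / 2 : ℝ)) ≤ 2 * Real.log (2 + T) := by
    have := Real.log_le_log (by positivity) (show 1 + (T : ℝ) ≤ 2 + T by linarith)
    linarith [log_one_add_rpow_le hd hT]
  have hτ1 : 1 ≤ Real.log (2 + (T : ℝ)) := by
    rw [Real.le_log_iff_exp_le (by positivity)]
    have := Real.exp_one_lt_d9
    linarith
  have hΛ : 0 ≤ Real.log (2 + X) := Real.log_nonneg (by linarith)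
  have h4 : √((Real.log (4 * T / δ) / d + Real.log (1 + 2 * √d * T)) *
      Real.log (1 + ((T : ℝ) / d) ^ (3 / 2 : ℝ))) ≤ 5 * (Real.log (2 + T) + Real.log (2 + X)) := by
    set τ := Real.log (2 + (T : ℝ))
    set Λ := Real.log (2 + X)
    refine Real.sqrt_le_iff.2 ⟨by positivity, ?_⟩
    calc _ ≤ (9 * τ + 2 * Λ) * (2 * τ) :=
          mul_le_mul (by linarith) h3 (log_one_add_rpow_pos hd hT).le (by positivity)
      _ ≤ _ := by nlinarith [mul_nonneg hΛ (zero_le_one.trans hτ1)]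
  unfold rate
  gcongr
  linarith

/-- If `√T` exceeds `Q log (2 + X)` by a large factor, it also absorbs `log (2 + T)`. -/
lemma mul_log_add_log_le_sqrt {T Q X : ℝ} (hT : 0 ≤ T) (hX : 0 < X) (hQ : 0 < Q)
    (hQX : Q ≤ 4 * X ^ 2) (h : 10 ^ 8 * (Q * Real.log (2 + X)) ≤ √T) :
    486 * (Q * (Real.log (2 + T) + Real.log (2 + X))) ≤ √T := by
  have hΛ2 : 1 / 2 ≤ Real.log (2 + X) := by
    have := Real.log_le_log (by norm_num) (show (2 : ℝ) ≤ 2 + X by linarith)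
    have := Real.log_two_gt_d9
    linarith
  have hΛX : Real.log (2 + X) ≤ 2 + X :=
    (Real.log_le_sub_one_of_pos (by positivity)).trans (by linarith)
  set Λ := Real.log (2 + X) with hΛ
  -- In terms of the surplus `κ`, `T = κ²Q²Λ²` with `Q` and `Λ` polynomially bounded in `X`. Hence
  -- `log (2 + T)` is at most `2 log κ + 10Λ`, and a large `κ` absorbs its own logarithm.
  set κ := √T / (Q * Λ) with hκ
  have hQΛ : 0 < Q * Λ := by positivity
  have hTκ : √T = κ * (Q * Λ) := by
    rw [hκ]
    field_simp
  have hκ0 : 10 ^ 8 ≤ κ := by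
    rw [hκ, le_div_iff₀ hQΛ]
    exact h
  have hκp : 0 < κ := by linarith
  have hτκ : Real.log (2 + T) ≤ 2 * Real.log κ + 10 * Λ := by
    have h1 : 2 + T ≤ κ ^ 2 * (2 + X) ^ 10 := by
      have h2 : T = κ ^ 2 * (Q ^ 2 * Λ ^ 2) := by
        rw [← Real.sq_sqrt hT, hTκ]
        ring
      have h3 : Q ^ 2 * Λ ^ 2 ≤ (4 * X ^ 2) ^ 2 * (2 + X) ^ 2 := by gcongr
      have h4 : 2 + (4 * X ^ 2) ^ 2 * (2 + X) ^ 2 ≤ (2 + X) ^ 10 := by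
        have h5 : (2 : ℝ) ^ 4 ≤ (2 + X) ^ 4 := by
          gcongr
          linarith
        have h6 : X ^ 4 + 2 ≤ (2 + X) ^ 4 := by
          have e : (2 + X) ^ 4 = X ^ 4 + 8 * X ^ 3 + 24 * X ^ 2 + 32 * X + 16 := by ring
          rw [e]
          have : 0 ≤ 8 * X ^ 3 + 24 * X ^ 2 + 32 * X := by positivity
          linarith
        have h7 : 1 ≤ (2 + X) ^ 2 := one_le_pow₀ (by linarith)
        calc 2 + (4 * X ^ 2) ^ 2 * (2 + X) ^ 2
            ≤ 32 * (2 + X) ^ 2 + (4 * X ^ 2) ^ 2 * (2 + X) ^ 2 := by linarith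
          _ = 2 ^ 4 * ((X ^ 4 + 2) * (2 + X) ^ 2) := by ring
          _ ≤ (2 + X) ^ 4 * ((2 + X) ^ 4 * (2 + X) ^ 2) := by gcongr
          _ = _ := by ring
      have h5 : 1 ≤ κ ^ 2 := one_le_pow₀ (by linarith)
      calc 2 + T = 2 + κ ^ 2 * (Q ^ 2 * Λ ^ 2) := by rw [← h2]
        _ ≤ κ ^ 2 * 2 + κ ^ 2 * ((4 * X ^ 2) ^ 2 * (2 + X) ^ 2) := by
          gcongr
          linarith
        _ = κ ^ 2 * (2 + (4 * X ^ 2) ^ 2 * (2 + X) ^ 2) := by ring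
        _ ≤ _ := by gcongr
    have h2 := Real.log_le_log (by positivity) h1
    rw [Real.log_mul (by positivity) (by positivity), Real.log_pow, Real.log_pow, ← hΛ] at h2
    push_cast at h2
    exact h2
  -- From `log κ ≤ 2√κ`, the left side is at most `3888√κ + 5346`, and `κ ≥ 10^8` means `κ ≥ 10^4
  -- √κ`.
  have hlog : 486 * (4 * Real.log κ + 11) ≤ κ := by
    have h1 : Real.log κ ≤ 2 * √κ := by
      have h2 := Real.log_le_sub_one_of_pos (Real.sqrt_pos.2 hκp)
      rw [Real.log_sqrt hκp.le] at h2
      linarith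
    have h2 : 10 ^ 4 ≤ √κ := Real.le_sqrt_of_sq_le (by linarith)
    have h3 : √κ * √κ = κ := Real.mul_self_sqrt hκp.le
    nlinarith
  have hlogκ : 0 ≤ Real.log κ := Real.log_nonneg (by linarith)
  have h1 : Real.log (2 + T) + Λ ≤ (4 * Real.log κ + 11) * Λ := by nlinarith
  calc 486 * (Q * (Real.log (2 + T) + Λ))
      ≤ 486 * (Q * ((4 * Real.log κ + 11) * Λ)) := by gcongr
    _ = 486 * (4 * Real.log κ + 11) * (Q * Λ) := by ring
    _ ≤ κ * (Q * Λ) := by gcongr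
    _ = _ := hTκ.symm

/-- Inversion of the rate: enough rounds make the average of the regret bound at most `ε`. -/
lemma rate_le_of_le {d T : ℕ} (hd : 1 ≤ d) (hT : 1 ≤ T) {D ε δ : ℝ} (hD : 1 ≤ D) (hε : 0 < ε)
    (hεd : ε ≤ 4 * √d) (hδ : 0 < δ) (hδ1 : δ < 1)
    (h : 2 * 10 ^ 16 * D ^ 4 * ((d : ℝ) ^ 2 / ε ^ 2) * Real.log (2 + D * d / (ε * δ)) ^ 2
      ≤ 2 * (T : ℝ)) :
    81 * D ^ 2 * rate d T δ ≤ T * ε := by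
  have hd0 : (1 : ℝ) ≤ d := by exact_mod_cast hd
  have hs1 : 1 ≤ √(d : ℝ) := Real.one_le_sqrt.2 hd0
  have hss : √(d : ℝ) * √d = d := Real.mul_self_sqrt (by positivity)
  set X := D * d / (ε * δ) with hX
  have hX0 : 0 < X := by positivity
  have hXδ : √(d : ℝ) / δ ≤ 4 * X := by
    rw [hX, mul_div_assoc', div_le_div_iff₀ hδ (by positivity)]
    have : √(d : ℝ) * ε ≤ 4 * (D * d) := by nlinarith
    nlinarith
  -- With this `Q` the regret bound becomes `486 Q (…) √T ε`, where `486 = 81 * 6`, so it remains to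
  -- compare `486 Q (…)` with `√T`.
  set Q := D ^ 2 * d / ε with hQ
  have hQ0 : 0 < Q := by positivity
  have hQX : Q ≤ 4 * X ^ 2 := by
    have h1 : D ≤ 4 * (D * d / ε) := by
      rw [mul_div_assoc', le_div_iff₀ hε]
      have : ε ≤ 4 * d := by nlinarith
      nlinarith
    have h2 : D * d / ε ≤ X := by
      rw [hX]
      gcongr
      nlinarith
    have h3 : 0 ≤ D * d / ε := by positivity
    calc Q = D * (D * d / ε) := by rw [hQ]; ring
      _ ≤ 4 * (D * d / ε) * (D * d / ε) := by gcongr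
      _ = 4 * (D * d / ε) ^ 2 := by ring
      _ ≤ 4 * X ^ 2 := by gcongr
  have hQT : 10 ^ 8 * (Q * Real.log (2 + X)) ≤ √T := by
    refine Real.le_sqrt_of_sq_le ?_
    have e : (10 ^ 8 * (Q * Real.log (2 + X))) ^ 2
        = 10 ^ 16 * D ^ 4 * ((d : ℝ) ^ 2 / ε ^ 2) * Real.log (2 + X) ^ 2 := by
      rw [hQ]
      ring
    rw [e]
    linarith
  have hmain := mul_log_add_log_le_sqrt (Nat.cast_nonneg T) hX0 hQ0 hQX hQT
  calc 81 * D ^ 2 * rate d T δ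
      ≤ 81 * D ^ 2 * (d * √T * (6 * (Real.log (2 + T) + Real.log (2 + X)))) := by
        gcongr
        exact rate_le_log hd hT hδ hδ1 hXδ
    _ = 486 * (Q * (Real.log (2 + T) + Real.log (2 + X))) * (√T * ε) := by
      rw [hQ]
      field_simp
      ring
    _ ≤ √T * (√T * ε) := by gcongr
    _ = T * ε := by
      rw [← mul_assoc, Real.mul_self_sqrt (by positivity)]

end VMG

theorem mainTheorem1 :
    ∃ C : ℝ, 0 < C ∧
      ∀ (m n d T : ℕ) (_hd : 1 ≤ d) (_hT : 1 ≤ T)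
        (R : VMG.Reg m n) (A : Matrix (Fin m) (Fin n) ℝ)
        (φ : Fin m → Fin n → EuclideanSpace ℝ (Fin d))
        (Θ : Set (EuclideanSpace ℝ (Fin d))) (ω₀ : EuclideanSpace ℝ (Fin d)) (B σ δ : ℝ)
        (_hφ : ∀ i j, ‖φ i j‖ ≤ 1)
        (_hΘ : Θ ⊆ Metric.closedBall 0 √d)
        (_hB : ∀ ω ∈ Θ, ∀ i j, |VMG.payoff φ ω i j| ≤ B)
        (_hreal : ∃ ω ∈ Θ, VMG.payoff φ ω = A)
        (_hω₀ : ω₀ ∈ Θ) (_hσ : 0 ≤ σ) (_hδ : 0 < δ) (_hδ1 : δ < 1)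
        (S : Type*) (_mS : MeasurableSpace S) (P : MeasureTheory.Measure S)
        (_hP : MeasureTheory.IsProbabilityMeasure P)
        (r : VMG.Run P R A φ Θ ω₀ (VMG.alpha d T δ) σ T),
        (1 - δ ≤ P.real {x | r.regret x ≤
          C * (1 + B + σ) ^ 2 * (d * √T) *
            (1 + √((Real.log (4 * T / δ) / d + Real.log (1 + 2 * √d * T)) *
              Real.log (1 + ((T : ℝ) / d) ^ (3 / 2 : ℝ))))}) ∧
        (∀ ε : ℝ, 0 < ε →
          C * (1 + B + σ) ^ 4 * ((d : ℝ) ^ 2 / ε ^ 2) *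
            Real.log (2 + (1 + B + σ) * d / (ε * δ)) ^ 2 ≤ 2 * (T : ℝ) →
          1 - δ ≤ P.real {x | ∃ k < T, VMG.IsApproxNash R A ε (r.μ k x) (r.ν k x)}) := by
  -- The square of the `10^8` in `mul_log_add_log_le_sqrt`, doubled because the condition bounds
  -- `2T`; it exceeds `81`.
  refine ⟨2 * 10 ^ 16, by norm_num, ?_⟩
  intro m n d T hd hT R A φ Θ ω₀ B σ δ hφ hΘ hB hreal hω₀ hσ hδ hδ1 S _ P _ r
  have hB0 : 0 ≤ B := R.bound_nonneg (hB ω₀ hω₀)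
  obtain ⟨E, hE, hr⟩ := r.exists_event_regret_le hd hT hφ hΘ hB hreal hω₀ hσ hδ hδ1
  refine ⟨VMG.one_sub_le_real_of_compl_subset hδ.le hE fun x hx => ?_, fun ε hε hTε => ?_⟩
  · refine (hr x hx).trans ?_
    rw [mul_assoc (2 * 10 ^ 16 * (1 + B + σ) ^ 2) (d * √(T : ℝ)), ← VMG.rate]
    have : 0 ≤ VMG.rate d T δ := by
      unfold VMG.rate
      positivity
    gcongr
    norm_num
  · have hnash : ∀ x, ∀ k < T, VMG.dualGap R A (r.μ k x) (r.ν k x) ≤ ε →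
        ∃ k < T, VMG.IsApproxNash R A ε (r.μ k x) (r.ν k x) := fun x k hk h =>
      ⟨k, hk, (r.nash k hk x).1, (r.nash k hk x).2.1, h⟩
    refine VMG.one_sub_le_real_of_compl_subset hδ.le hE fun x hx => ?_
    -- All payoffs are at most `√d` by Cauchy–Schwarz, so gaps never exceed `4√d` and for larger `ε`
    -- the first iterate already works. For smaller `ε` the inversion applies, and some gap is at
    -- most the average.
    rcases le_or_gt ε (4 * √d) with hεd | hεd
    · have h1 := (hr x hx).trans
        (VMG.rate_le_of_le hd hT (by linarith) hε hεd hδ hδ1 hTε)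
      have h2 : ∑ k ∈ Finset.range T, VMG.dualGap R A (r.μ k x) (r.ν k x)
          ≤ ∑ _k ∈ Finset.range T, ε := by
        rw [Finset.sum_const, Finset.card_range, nsmul_eq_mul]
        exact h1
      obtain ⟨k, hk, hle⟩ := Finset.exists_le_of_sum_le (by simpa using by omega) h2
      exact hnash x k (Finset.mem_range.1 hk) hle
    · exact hnash x 0 hT ((r.dualGap_le_of_bound (fun ω hω => VMG.abs_payoff_le hφ
        (mem_closedBall_zero_iff.1 (hΘ hω))) hreal hω₀ hT x).trans hεd.le)
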